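/- In the problem Assignment Clique Cover (ACC), an instance is a pair $(G,t)$ of a finite simple graph $G=(V,E)$ with $n=|V|$ and an integer $t\ge 0$. A solution is a set $\mathcal{C}$ of cliques of $G$ such that every edge of $G$ is contained in at least one clique of $\mathcal{C}$ and $\sum_{C\in\mathcal{C}}|C|\le t$. The task is to output a solution if one exists, and NO otherwise. Theorem. ACC, parameterized by $t$, has a fixed-parameter tractable algorithm running in $4^{t\log_2 t}\,n^{O(1)}$ time (where $t\log_2 t:=0$ for $t=0$). That is, there are a single random access machine program $A$ and a constant $c$ such that, for every graph $G$ with $n$ vertices and every $t\ge 0$, the program $A$ on the input $(G,t)$ (with $G$ given by its adjacency matrix) halts after at most $c\cdot 4^{t\log_2 t}\,(n+1)^{c}$ elementary steps with a solution of $(G,t)$ if one exists, and with the answer NO otherwise. -/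

import Mathlib

/-! ### Random access machines

A successor random access machine: finitely many registers (those a program mentions) and an
unbounded array of memory cells, all holding natural numbers.  Every elementary instruction and
every evaluation of a test costs one time unit.  The only arithmetic is `+ 1` and truncated `- 1`,
so no large numbers can be built in few steps.  Programs are written in structured form;
each construct amounts to a bounded number of instructions with jumps. -/

namespace RAM

/-- The contents of the registers and of the memory. -/
structure State where
  reg : ℕ → ℕ
  mem : ℕ → ℕ

/-- Comparisons of two registers. -/
inductive Test where
  | lt (a b : ℕ)
  | eq (a b : ℕ)

/-- The truth value of a test in a state. -/
def Test.Holds : Test → State → Prop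
  | .lt a b, s => s.reg a < s.reg b
  | .eq a b, s => s.reg a = s.reg b

/-- Programs; the natural numbers `a`, `b` are names of registers, `k` is a constant. -/
inductive Prog where
  | skip
  | const (a k : ℕ)
  | copy (a b : ℕ)
  | inc (a : ℕ)
  | dec (a : ℕ)
  | load (a b : ℕ)
  | store (a b : ℕ)
  | seq (p q : Prog)
  | cond (c : Test) (p q : Prog)
  | loop (c : Test) (p : Prog)

/-- Assign the value `v` to register `a`. -/
def State.setReg (s : State) (a v : ℕ) : State :=
  { s with reg := Function.update s.reg a v }

/-- Assign the value `v` to the memory cell with address `i`. -/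
def State.setMem (s : State) (i v : ℕ) : State :=
  { s with mem := Function.update s.mem i v }

/-- `Exec p s T s'`: the program `p`, started in state `s`, halts after exactly `T` time units
in state `s'`. -/
inductive Exec : Prog → State → ℕ → State → Prop where
  | skip (s : State) : Exec .skip s 1 s
  | const (a k : ℕ) (s : State) : Exec (.const a k) s 1 (s.setReg a k)
  | copy (a b : ℕ) (s : State) : Exec (.copy a b) s 1 (s.setReg a (s.reg b))
  | inc (a : ℕ) (s : State) : Exec (.inc a) s 1 (s.setReg a (s.reg a + 1))
  | dec (a : ℕ) (s : State) : Exec (.dec a) s 1 (s.setReg a (s.reg a - 1))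
  | load (a b : ℕ) (s : State) : Exec (.load a b) s 1 (s.setReg a (s.mem (s.reg b)))
  | store (a b : ℕ) (s : State) : Exec (.store a b) s 1 (s.setMem (s.reg a) (s.reg b))
  | seq {p q : Prog} {s s' s'' : State} {T T' : ℕ} :
      Exec p s T s' → Exec q s' T' s'' → Exec (.seq p q) s (T + T') s''
  | cond_true {c : Test} {p q : Prog} {s s' : State} {T : ℕ} :
      c.Holds s → Exec p s T s' → Exec (.cond c p q) s (1 + T) s'
  | cond_false {c : Test} {p q : Prog} {s s' : State} {T : ℕ} :
      ¬ c.Holds s → Exec q s T s' → Exec (.cond c p q) s (1 + T) s'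
  | loop_true {c : Test} {p : Prog} {s s' s'' : State} {T T' : ℕ} :
      c.Holds s → Exec p s T s' → Exec (.loop c p) s' T' s'' →
        Exec (.loop c p) s (1 + T + T') s''
  | loop_false {c : Test} {p : Prog} {s : State} :
      ¬ c.Holds s → Exec (.loop c p) s 1 s

/-- The machine is deterministic: running time and final state are determined by the program
and the initial state. -/
theorem Exec.deterministic {p : Prog} {s s₁ s₂ : State} {T₁ T₂ : ℕ}
    (h₁ : Exec p s T₁ s₁) (h₂ : Exec p s T₂ s₂) : T₁ = T₂ ∧ s₁ = s₂ := by
  induction h₁ generalizing T₂ s₂ with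
  | seq _ _ ih ih' =>
    cases h₂ with
    | seq k k' =>
      obtain ⟨rfl, rfl⟩ := ih k
      obtain ⟨rfl, rfl⟩ := ih' k'
      exact ⟨rfl, rfl⟩
  | cond_true hc _ ih =>
    cases h₂ with
    | cond_true _ k => obtain ⟨rfl, rfl⟩ := ih k; exact ⟨rfl, rfl⟩
    | cond_false hn _ => exact absurd hc hn
  | cond_false hn _ ih =>
    cases h₂ with
    | cond_true hc _ => exact absurd hc hn
    | cond_false _ k => obtain ⟨rfl, rfl⟩ := ih k; exact ⟨rfl, rfl⟩
  | loop_true hc _ _ ih ih' =>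
    cases h₂ with
    | loop_true _ k k' =>
      obtain ⟨rfl, rfl⟩ := ih k
      obtain ⟨rfl, rfl⟩ := ih' k'
      exact ⟨rfl, rfl⟩
    | loop_false hn => exact absurd hc hn
  | loop_false hn =>
    cases h₂ with
    | loop_true hc _ _ => exact absurd hc hn
    | loop_false _ => exact ⟨rfl, rfl⟩
  | _ => cases h₂; exact ⟨rfl, rfl⟩

end RAM

/-! ### Assignment Clique Cover -/

namespace AssignmentCliqueCover

/-- `C` is a solution of the instance `(G, t)`: a set of cliques of `G` such that every edge of `G`
is contained in one of them and the sum of their sizes is at most `t`. -/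
def IsSolution {n : ℕ} (G : SimpleGraph (Fin n)) (t : ℕ) (C : Finset (Finset (Fin n))) : Prop :=
  (∀ K ∈ C, G.IsClique (K : Set (Fin n))) ∧
  (∀ x y : Fin n, G.Adj x y → ∃ K ∈ C, x ∈ K ∧ y ∈ K) ∧
  ∑ K ∈ C, K.card ≤ t

open Classical in
/-- The initial state for the instance `(G, t)`: register `0` holds the number `n` of vertices,
register `1` holds `t`, and cell `n * x + y` with `x, y < n` holds the entry of the adjacency matrix
at `(x, y)`.  All other registers and cells hold `0`. -/
noncomputable def input {n : ℕ} (G : SimpleGraph (Fin n)) (t : ℕ) : RAM.State where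
  reg r := if r = 0 then n else if r = 1 then t else 0
  mem i := if ∃ x y : Fin n, G.Adj x y ∧ i = n * (x : ℕ) + (y : ℕ) then 1 else 0

/-- The answer in a final state: `none` (that is, NO) if register `0` holds `0`.
Otherwise, with `k` the content of register `1`, the set of the `k` vertex sets
of which the `i`-th one has its membership table in the cells `n * i, …, n * i + n - 1`. -/
def output (n : ℕ) (s : RAM.State) : Option (Finset (Finset (Fin n))) :=
  if s.reg 0 = 0 then none
  else some ((Finset.range (s.reg 1)).image fun i =>
    Finset.univ.filter fun x : Fin n => s.mem (n * i + (x : ℕ)) ≠ 0)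

/-- The answer is right: a solution if one exists, and NO otherwise. -/
def IsCorrectAnswer {n : ℕ} (G : SimpleGraph (Fin n)) (t : ℕ) :
    Option (Finset (Finset (Fin n))) → Prop
  | some C => IsSolution G t C
  | none => ¬ ∃ C : Finset (Finset (Fin n)), IsSolution G t C

/-- The program `A` solves the problem, and on every instance `(G, t)` with `n` vertices
it halts after at most `f n t` time units. -/
def SolvesInTime (A : RAM.Prog) (f : ℕ → ℕ → ℝ) : Prop :=
  ∀ (n : ℕ) (G : SimpleGraph (Fin n)) (t : ℕ), ∃ (T : ℕ) (s : RAM.State),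
    RAM.Exec A (input G t) T s ∧ IsCorrectAnswer G t (output n s) ∧ (T : ℝ) ≤ f n t

end AssignmentCliqueCover

/-! ### Total correctness with time bounds -/

namespace RAM

/-! Think of a cover of total size at most `t` as a table of vertex sets and recover it lazily. Run
through the adjacent pairs; whenever the current pair lies in no set built so far, guess the index
of a set and put both endpoints into it. The indices are the base-`B` digits of one number `N`, the
lowest digit being used first, where `B = max t 1` and `t` has already been capped as explained
below.

Whatever `N` is, the resulting table covers every edge (`covered_scan`), so only its size and the
clique property have to be tested. Conversely, let a solution be given. Always guessing a set of the
solution that contains the pair keeps the table inside the solution, and each guess creates at least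
one new incidence, since otherwise the pair would have been covered. Hence at most `t` digits are
needed, and some `N < B ^ t` succeeds (`staysIn_scanStep`, `exists_isCliqueTable_scan`). Trying all
these `N` decides the instance.

The edges themselves form a solution of size at most `n * n`, so `t` may be replaced by `min t (n *
n)`. This makes `B` and all addresses polynomial in `n`.

The machine divides by counting, so extracting a digit of `N` costs time linear in `N`. Thus there
are `B ^ t` guesses, each costing at most a polynomial times `B ^ t`; the total `(t ^ t) ^ 2` times
a polynomial is the claimed bound, because `4 ^ (t * log₂ t) = (t ^ t) ^ 2`. -/

/-- The registers a program may change. -/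
def Prog.writes : Prog → List ℕ
  | .skip => []
  | .const a _ => [a]
  | .copy a _ => [a]
  | .inc a => [a]
  | .dec a => [a]
  | .load a _ => [a]
  | .store _ _ => []
  | .seq p q => p.writes ++ q.writes
  | .cond _ p q => p.writes ++ q.writes
  | .loop _ p => p.writes

/-- The program does not write to the memory. -/
def Prog.storeFree : Prog → Bool
  | .store _ _ => false
  | .seq p q => p.storeFree && q.storeFree
  | .cond _ p q => p.storeFree && q.storeFree
  | .loop _ p => p.storeFree
  | _ => true

@[simp] theorem State.setReg_reg (s : State) (a v r : ℕ) :
    (s.setReg a v).reg r = if r = a then v else s.reg r := by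
  simp [State.setReg, Function.update_apply]

@[simp] theorem State.setReg_mem (s : State) (a v : ℕ) : (s.setReg a v).mem = s.mem := rfl

@[simp] theorem State.setMem_reg (s : State) (i v : ℕ) : (s.setMem i v).reg = s.reg := rfl

@[simp] theorem State.setMem_mem (s : State) (i v j : ℕ) :
    (s.setMem i v).mem j = if j = i then v else s.mem j := by
  simp [State.setMem, Function.update_apply]

/-- The states `s` and `s'` differ only in what the program `p` may change. -/
structure Frame (p : Prog) (s s' : State) : Prop where
  reg : ∀ r, r ∉ p.writes → s'.reg r = s.reg r
  mem : p.storeFree = true → s'.mem = s.mem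

/-- Reduces the preservation of registers and memory to a syntactic condition on the program, which
`decide` or `rfl` settles for concrete programs. -/
theorem Exec.frame {p : Prog} {s s' : State} {T : ℕ} (h : Exec p s T s') : Frame p s s' := by
  induction h with
  | skip | loop_false => exact ⟨fun _ _ => rfl, fun _ => rfl⟩
  | const | copy | inc | dec | load =>
    refine ⟨fun r hr => ?_, fun _ => rfl⟩
    simp [Prog.writes] at hr
    simp [hr]
  | store => exact ⟨fun _ _ => rfl, fun h => by simp [Prog.storeFree] at h⟩
  | seq _ _ ih ih' =>
    refine ⟨fun r hr => ?_, fun h => ?_⟩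
    · simp [Prog.writes] at hr
      rw [ih'.reg r hr.2, ih.reg r hr.1]
    · simp [Prog.storeFree] at h
      rw [ih'.mem h.2, ih.mem h.1]
  | cond_true _ _ ih =>
    refine ⟨fun r hr => ?_, fun h => ?_⟩
    · simp [Prog.writes] at hr
      rw [ih.reg r hr.1]
    · simp [Prog.storeFree] at h
      rw [ih.mem h.1]
  | cond_false _ _ ih =>
    refine ⟨fun r hr => ?_, fun h => ?_⟩
    · simp [Prog.writes] at hr
      rw [ih.reg r hr.2]
    · simp [Prog.storeFree] at h
      rw [ih.mem h.2]
  | loop_true _ _ _ ih ih' =>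
    refine ⟨fun r hr => ?_, fun h => ?_⟩
    · rw [ih'.reg r hr, ih.reg r hr]
    · rw [ih'.mem h, ih.mem h]

/-- Started in `s`, the program `p` halts after at most `T` time units in a state satisfying `Q`. -/
def Does (p : Prog) (s : State) (T : ℕ) (Q : State → Prop) : Prop :=
  ∃ (T' : ℕ) (s' : State), Exec p s T' s' ∧ T' ≤ T ∧ Q s'

namespace Does

variable {p q : Prog} {s : State} {T T' : ℕ} {Q R : State → Prop}

theorem mono (h : Does p s T Q) (hT : T ≤ T') (hQ : ∀ s', Frame p s s' → Q s' → R s') :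
    Does p s T' R := by
  obtain ⟨t, s', h, ht, hq⟩ := h
  exact ⟨t, s', h, ht.trans hT, hQ s' h.frame hq⟩

theorem le (h : Does p s T Q) (hT : T ≤ T') : Does p s T' Q :=
  h.mono hT fun _ _ h => h

theorem imp (h : Does p s T Q) (hQ : ∀ s', Frame p s s' → Q s' → R s') : Does p s T R :=
  h.mono le_rfl hQ

theorem skip (h : Q s) : Does .skip s 1 Q := ⟨1, s, .skip s, le_rfl, h⟩

theorem const {a k : ℕ} (h : Q (s.setReg a k)) : Does (.const a k) s 1 Q :=
  ⟨1, _, .const a k s, le_rfl, h⟩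

theorem copy {a b : ℕ} (h : Q (s.setReg a (s.reg b))) : Does (.copy a b) s 1 Q :=
  ⟨1, _, .copy a b s, le_rfl, h⟩

theorem inc {a : ℕ} (h : Q (s.setReg a (s.reg a + 1))) : Does (.inc a) s 1 Q :=
  ⟨1, _, .inc a s, le_rfl, h⟩

theorem load {a b : ℕ} (h : Q (s.setReg a (s.mem (s.reg b)))) : Does (.load a b) s 1 Q :=
  ⟨1, _, .load a b s, le_rfl, h⟩

theorem store {a b : ℕ} (h : Q (s.setMem (s.reg a) (s.reg b))) : Does (.store a b) s 1 Q :=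
  ⟨1, _, .store a b s, le_rfl, h⟩

theorem seq (h : Does p s T Q) (h' : ∀ s', Frame p s s' → Q s' → Does q s' T' R) :
    Does (.seq p q) s (T + T') R := by
  obtain ⟨t, s', h, ht, hq⟩ := h
  obtain ⟨t', s'', k, ht', hr⟩ := h' s' h.frame hq
  exact ⟨t + t', s'', .seq h k, by omega, hr⟩

theorem cond {c : Test} (h : c.Holds s → Does p s T Q) (h' : ¬ c.Holds s → Does q s T Q) :
    Does (.cond c p q) s (1 + T) Q := by
  by_cases hc : c.Holds s
  · obtain ⟨t, s', k, ht, hq⟩ := h hc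
    exact ⟨1 + t, s', .cond_true hc k, by omega, hq⟩
  · obtain ⟨t, s', k, ht, hq⟩ := h' hc
    exact ⟨1 + t, s', .cond_false hc k, by omega, hq⟩

end Does

/-! ### Counting loops and multiplication. -/

/-- Run `p` with register `i` ranging from the content of `lo` up to, and excluding, that
of `hi`. -/
def forRange (i lo hi : ℕ) (p : Prog) : Prog :=
  .seq (.copy i lo) (.loop (.lt i hi) (.seq p (.inc i)))

/-- Induction on the number of rounds left. A round costs the body, one test and one increment; the
initial copy and the final failing test give the summand `2`. The body may use the frame relative to
the start of the whole loop, so the invariant need not mention what the loop never changes. -/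
theorem Does.forRange {i lo hi a b T : ℕ} {p : Prog} {s : State} (I : ℕ → State → Prop)
    (hi' : i ∉ p.writes) (hhi : hi ∉ p.writes) (hne : hi ≠ i)
    (hlo : s.reg lo = a) (hb : s.reg hi = b) (hab : a ≤ b) (h0 : I a (s.setReg i a))
    (step : ∀ k s', a ≤ k → k < b → s'.reg i = k → Frame (forRange i lo hi p) s s' → I k s' →
      Does p s' T fun s'' => I (k + 1) (s''.setReg i (k + 1))) :
    Does (forRange i lo hi p) s (2 + (b - a) * (T + 2)) (I b) := by
  have main : ∀ d k s', k + d = b → a ≤ k → s'.reg i = k → Frame (RAM.forRange i lo hi p) s s' →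
      I k s' → Does (.loop (.lt i hi) (.seq p (.inc i))) s' (1 + d * (T + 2)) (I b) := by
    intro d
    induction d with
    | zero =>
      intro k s' hk hak hik hf hI
      have hhb : s'.reg hi = b := by
        rw [hf.reg hi (by simp [RAM.forRange, Prog.writes, hne, hhi]), hb]
      refine ⟨1, s', .loop_false ?_, by omega, ?_⟩
      · simp only [Test.Holds]; omega
      · have : k = b := by omega
        exact this ▸ hI
    | succ d ih =>
      intro k s' hk hak hik hf hI
      have hhb : s'.reg hi = b := by
        rw [hf.reg hi (by simp [RAM.forRange, Prog.writes, hne, hhi]), hb]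
      obtain ⟨t, s₁, h₁, ht, hQ⟩ := step k s' hak (by omega) hik hf hI
      have hi₁ : s₁.reg i = k := by rw [h₁.frame.reg i hi', hik]
      have hx : Exec (.seq p (.inc i)) s' (t + 1) (s₁.setReg i (k + 1)) := by
        have := Exec.inc i s₁
        rw [hi₁] at this
        exact .seq h₁ this
      have hf' : Frame (RAM.forRange i lo hi p) s (s₁.setReg i (k + 1)) := by
        refine ⟨fun r hr => ?_, fun h => ?_⟩
        · rw [hx.frame.reg r, hf.reg r hr]
          simp [RAM.forRange, Prog.writes] at hr ⊢
          exact hr.2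
        · rw [hx.frame.mem, hf.mem h]
          simp [RAM.forRange, Prog.storeFree] at h ⊢
          exact h
      obtain ⟨t', s₂, h₂, ht', hI'⟩ := ih (k + 1) _ (by omega) (by omega) (by simp) hf' hQ
      refine ⟨1 + (t + 1) + t', s₂, .loop_true ?_ hx h₂, ?_, hI'⟩
      · simp only [Test.Holds]; omega
      · rw [Nat.succ_mul]; omega
  have hf : Frame (RAM.forRange i lo hi p) s (s.setReg i a) := by
    refine ⟨fun r hr => ?_, fun h => rfl⟩
    simp [RAM.forRange, Prog.writes] at hr
    simp [hr]
  have := Does.seq (p := .copy i lo) (s := s) (T := 1) (Q := fun s' => s' = s.setReg i a)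
    (Does.copy (by rw [hlo])) (R := I b) (T' := 1 + (b - a) * (T + 2))
    (q := .loop (.lt i hi) (.seq p (.inc i))) (by
      rintro s' - rfl
      exact main (b - a) a _ (by omega) le_rfl (by simp) hf h0)
  exact this.le (by omega)

/-- A loop whose body clears the flag `f` unless `Q` holds of the loop variable. -/
theorem Does.forRange_flag {i lo hi f a b T : ℕ} {p : Prog} {s : State} (Q : ℕ → Prop)
    (hi' : i ∉ p.writes) (hhi : hi ∉ p.writes) (hne : hi ≠ i) (hfi : f ≠ i)
    (hlo : s.reg lo = a) (hb : s.reg hi = b) (hab : a ≤ b)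
    (step : ∀ k s', a ≤ k → k < b → s'.reg i = k → Frame (RAM.forRange i lo hi p) s s' →
      Does p s' T fun s'' => s''.reg f ≠ 0 ↔ s'.reg f ≠ 0 ∧ Q k) :
    Does (RAM.forRange i lo hi p) s (2 + (b - a) * (T + 2)) fun s' =>
      s'.reg f ≠ 0 ↔ s.reg f ≠ 0 ∧ ∀ k, a ≤ k → k < b → Q k := by
  refine Does.forRange (fun j s' => s'.reg f ≠ 0 ↔ s.reg f ≠ 0 ∧ ∀ k, a ≤ k → k < j → Q k)
    hi' hhi hne hlo hb hab ?_ ?_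
  · simp only [State.setReg_reg, hfi, if_false]
    exact ⟨fun h => ⟨h, fun k h₁ h₂ => absurd h₁ (by omega)⟩, fun h => h.1⟩
  · intro k s' hak hkb hik hf hI
    refine (step k s' hak hkb hik hf).imp fun s'' _ h => ?_
    simp only [State.setReg_reg, hfi, if_false]
    rw [h, hI, and_assoc]
    refine and_congr_right fun _ => ⟨fun h j h₁ h₂ => ?_, fun h => ⟨fun j h₁ h₂ => h j h₁ (by omega),
      h k hak (by omega)⟩⟩
    obtain rfl | h₂ : j = k ∨ j < k := by omega
    · exact h.2
    · exact h.1 j h₁ h₂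

/-- Add the product of the registers `a` and `b` to register `d`, given that register `2`
holds `0`. -/
def addMul (d a b : ℕ) : Prog := forRange 16 2 a (forRange 17 2 b (.inc d))

/-- With increments as the only growing arithmetic, a product is obtained by two nested loops, in
time proportional to its value up to lower terms. Accumulating into `d` lets the same routine
compute addresses `n * row + col`. -/
theorem Does.addMul {d a b : ℕ} {s : State} (h : s.reg 2 = 0) (hd : d ∉ [a, b, 2, 16, 17])
    (ha : a ∉ [16, 17]) (hb : b ∉ [16, 17]) :
    Does (addMul d a b) s (2 + s.reg a * (4 + 3 * s.reg b))
      fun s' => s'.reg d = s.reg d + s.reg a * s.reg b := by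
  simp only [List.mem_cons, List.not_mem_nil, or_false, not_or] at hd ha hb
  obtain ⟨hda, hdb, hd2, hd6, hd7⟩ := hd
  refine (Does.forRange (a := 0) (b := s.reg a) (T := 2 + s.reg b * 3)
    (fun k s' => s'.reg d = s.reg d + k * s.reg b) ?_ ?_ ha.1 h rfl (Nat.zero_le _) ?_ ?_).le ?_
  · simp [RAM.forRange, Prog.writes, Ne.symm hd6]
  · simp [RAM.forRange, Prog.writes, ha.2, Ne.symm hda]
  · simp [hd6]
  · intro k s' _ _ _ hf hI
    have hb' : s'.reg b = s.reg b :=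
      hf.reg b (by simp [RAM.forRange, Prog.writes, hb.1, hb.2, Ne.symm hdb])
    have h2' : s'.reg 2 = 0 := by
      rw [hf.reg 2 (by simp [RAM.forRange, Prog.writes, Ne.symm hd2]), h]
    refine (Does.forRange (a := 0) (b := s.reg b) (T := 1)
      (fun k' s'' => s''.reg d = s.reg d + k * s.reg b + k') ?_ ?_ hb.2 h2' hb' (Nat.zero_le _)
        ?_ ?_).mono ?_ ?_
    · simp [Prog.writes, Ne.symm hd7]
    · simp [Prog.writes, Ne.symm hdb]
    · simp [hd7, hI]
    · intro k' s'' _ _ _ _ h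
      exact Does.inc (by simp [hd7, h, add_assoc])
    · omega
    · intro s'' _ h
      simp [hd6, h, Nat.succ_mul, add_assoc]
  · simp only [Nat.sub_zero]
    exact Nat.add_le_add_left (Nat.mul_le_mul_left _ (by omega)) _

end RAM

/-! ### The search

Vertex sets are kept in a memory of rows of length `n`: the cell `n * i + x` of row `i` belongs to
the vertex `x`.  The rows `0, …, n - 1` hold the adjacency matrix, the rows `n, …, n + B - 1`
a table of `B` vertex sets.  A table is given by the set of its nonzero cells. -/

namespace AssignmentCliqueCover

open Finset

/-- Some vertex set of the table `S` contains both `x` and `y`. -/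
def Covered (n B : ℕ) (S : Finset ℕ) (x y : ℕ) : Prop :=
  ∃ i, n ≤ i ∧ i < n + B ∧ n * i + x ∈ S ∧ n * i + y ∈ S

/-- The total size of the table is at most `t`, and its vertex sets are cliques. -/
def IsCliqueTable (n B t : ℕ) (E : Set ℕ) (S : Finset ℕ) : Prop :=
  #S ≤ t ∧ ∀ i, n ≤ i → i < n + B → ∀ x, 0 ≤ x → x < n → ∀ y, 0 ≤ y → y < n →
    n * i + x ∈ S → n * i + y ∈ S → x ≠ y → n * x + y ∈ E

open Classical in
/-- If `x` and `y` are adjacent and not covered, put both into the vertex set that is named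
by the last digit of the guess in base `B`, and drop this digit. -/
noncomputable def scanStep (n B : ℕ) (E : Set ℕ) (x y : ℕ) (σ : ℕ × Finset ℕ) : ℕ × Finset ℕ :=
  if n * x + y ∈ E ∧ ¬ Covered n B σ.2 x y then
    (σ.1 / B, insert (n * (n + σ.1 % B) + y) (insert (n * (n + σ.1 % B) + x) σ.2))
  else σ

/-- Treat the pairs `(x, y)` with `y < k`. -/
noncomputable def scanRow (n B : ℕ) (E : Set ℕ) (x k : ℕ) (σ : ℕ × Finset ℕ) : ℕ × Finset ℕ :=
  (List.range k).foldl (fun σ y => scanStep n B E x y σ) σ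

/-- Treat the pairs `(x, y)` with `x < k` and `y < n`. -/
noncomputable def scanRows (n B : ℕ) (E : Set ℕ) (k : ℕ) (σ : ℕ × Finset ℕ) : ℕ × Finset ℕ :=
  (List.range k).foldl (fun σ x => scanRow n B E x n σ) σ

/-- The table that results from the guess `N`. -/
noncomputable def scan (n B : ℕ) (E : Set ℕ) (N : ℕ) : Finset ℕ :=
  (scanRows n B E n (N, ∅)).2

/-! ### Every guess yields a covering table. -/

section

variable {n B t : ℕ} {E : Set ℕ} {x y k : ℕ} {S S' : Finset ℕ} {σ : ℕ × Finset ℕ}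

theorem Covered.mono (h : Covered n B S x y) (hS : S ⊆ S') : Covered n B S' x y := by
  obtain ⟨i, h₁, h₂, hx, hy⟩ := h
  exact ⟨i, h₁, h₂, hS hx, hS hy⟩

theorem scanRow_succ :
    scanRow n B E x (k + 1) σ = scanStep n B E x k (scanRow n B E x k σ) := by
  simp [scanRow, List.range_succ]

theorem scanRows_succ :
    scanRows n B E (k + 1) σ = scanRow n B E k n (scanRows n B E k σ) := by
  simp [scanRows, List.range_succ]

theorem subset_scanStep : σ.2 ⊆ (scanStep n B E x y σ).2 := by
  unfold scanStep
  split_ifs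
  · exact (subset_insert _ _).trans (subset_insert _ _)
  · exact Subset.rfl

theorem subset_scanRow : σ.2 ⊆ (scanRow n B E x k σ).2 := by
  induction k with
  | zero => simp [scanRow]
  | succ k ih => rw [scanRow_succ]; exact ih.trans subset_scanStep

theorem covered_scanStep (hB : 0 < B) (h : n * x + y ∈ E) :
    Covered n B (scanStep n B E x y σ).2 x y := by
  unfold scanStep
  split_ifs with hc
  · exact ⟨n + σ.1 % B, by omega, by have := Nat.mod_lt σ.1 hB; omega, by simp, by simp⟩
  · tauto

theorem covered_scanRow (hB : 0 < B) (hy : y < k) (h : n * x + y ∈ E) :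
    Covered n B (scanRow n B E x k σ).2 x y := by
  induction k with
  | zero => omega
  | succ k ih =>
    rw [scanRow_succ]
    obtain rfl | hy : y = k ∨ y < k := by omega
    · exact covered_scanStep hB h
    · exact (ih hy).mono subset_scanStep

theorem covered_scanRows (hB : 0 < B) (hx : x < k) (hy : y < n) (h : n * x + y ∈ E) :
    Covered n B (scanRows n B E k σ).2 x y := by
  induction k with
  | zero => omega
  | succ k ih =>
    rw [scanRows_succ]
    obtain rfl | hx : x = k ∨ x < k := by omega
    · exact covered_scanRow hB hy h
    · exact (ih hx).mono subset_scanRow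

theorem cell_mem_Ico {m i : ℕ} (hx : x < n) (hm : m ≤ i) (hi : i < k) :
    n * i + x ∈ Ico (n * m) (n * k) := by
  have h₁ : n * m ≤ n * i := Nat.mul_le_mul_left _ hm
  have h₂ : n * (i + 1) ≤ n * k := Nat.mul_le_mul_left _ hi
  rw [Nat.mul_succ] at h₂
  rw [mem_Ico]
  omega

/-- Any remainder modulo `B` names a row of the table, so an edge is covered once it has been
treated, and later steps only enlarge the table. Hence the program never tests covering. -/
theorem covered_scan (hB : 0 < B) (hx : x < n) (hy : y < n) (h : n * x + y ∈ E) (N : ℕ) :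
    Covered n B (scan n B E N) x y :=
  covered_scanRows hB hx hy h

/-! ### Some small guess follows a given solution. -/

/-- From every table contained in `S` and for a suitable guess, `F` leads to a table contained
in `S` and to any prescribed remaining guess, with at most one digit for each new cell. -/
def StaysIn (B : ℕ) (S : Finset ℕ) (F : ℕ × Finset ℕ → ℕ × Finset ℕ) : Prop :=
  ∀ U ⊆ S, ∃ U', U ⊆ U' ∧ U' ⊆ S ∧
    ∀ M', ∃ M, F (M, U) = (M', U') ∧ M + 1 ≤ (M' + 1) * B ^ (#U' - #U)

theorem StaysIn.id : StaysIn B S fun σ => σ :=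
  fun U hU => ⟨U, Subset.rfl, hU, fun M' => ⟨M', rfl, by simp⟩⟩

/-- Tables are followed forwards but guesses are assembled backwards: the first step consumes the
lowest digit, so its input is built from what the second step still needs. This is why the table
`U'` in `StaysIn` is chosen before `M'`. -/
theorem StaysIn.comp {F F' : ℕ × Finset ℕ → ℕ × Finset ℕ} (h' : StaysIn B S F')
    (h : StaysIn B S F) : StaysIn B S fun σ => F' (F σ) := by
  intro U hU
  obtain ⟨U₁, hUU₁, hU₁, h₁⟩ := h U hU
  obtain ⟨U₂, hUU₂, hU₂, h₂⟩ := h' U₁ hU₁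
  refine ⟨U₂, hUU₁.trans hUU₂, hU₂, fun M₂ => ?_⟩
  obtain ⟨M₁, e₂, le₂⟩ := h₂ M₂
  obtain ⟨M, e₁, le₁⟩ := h₁ M₁
  refine ⟨M, by simp only [e₁, e₂], le₁.trans ?_⟩
  have := card_le_card hUU₁
  have := card_le_card hUU₂
  calc (M₁ + 1) * B ^ (#U₁ - #U) ≤ (M₂ + 1) * B ^ (#U₂ - #U₁) * B ^ (#U₁ - #U) :=
        Nat.mul_le_mul_right _ le₂
    _ = (M₂ + 1) * B ^ (#U₂ - #U) := by rw [mul_assoc, ← pow_add]; congr 2; omega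

/-- For an uncovered edge, take a row `i` of `S` containing both ends and append the digit `i - n`.
At least one of the two cells is new, as otherwise the edge would already be covered, so the growth
of the table pays for the digit. -/
theorem staysIn_scanStep (h : n * x + y ∈ E → Covered n B S x y) :
    StaysIn B S (scanStep n B E x y) := by
  intro U hU
  by_cases hc : n * x + y ∈ E ∧ ¬ Covered n B U x y
  · obtain ⟨i, hni, hiB, hx, hy⟩ := h hc.1
    have hB : i - n < B := by omega
    have hd : n + (i - n) = i := by omega
    refine ⟨insert (n * i + y) (insert (n * i + x) U),
      (subset_insert _ _).trans (subset_insert _ _),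
      insert_subset hy (insert_subset hx hU), fun M' => ⟨M' * B + (i - n), ?_, ?_⟩⟩
    · unfold scanStep
      rw [if_pos hc]
      have h₁ : (M' * B + (i - n)) / B = M' := by
        rw [mul_comm, Nat.mul_add_div (by omega), Nat.div_eq_of_lt hB, add_zero]
      have h₂ : (M' * B + (i - n)) % B = i - n := by
        rw [mul_comm, Nat.mul_add_mod, Nat.mod_eq_of_lt hB]
      simp only [h₁, h₂, hd]
    · have hlt : #U < #(insert (n * i + y) (insert (n * i + x) U)) := by
        refine card_lt_card (ssubset_of_subset_not_subset
          ((subset_insert _ _).trans (subset_insert _ _)) fun hs => hc.2 ⟨i, hni, hiB, ?_, ?_⟩)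
        · exact hs (by simp)
        · exact hs (by simp)
      calc M' * B + (i - n) + 1 ≤ (M' + 1) * B ^ 1 := by rw [pow_one, Nat.succ_mul]; omega
        _ ≤ _ := Nat.mul_le_mul_left _ (Nat.pow_le_pow_right (by omega) (by omega))
  · exact ⟨U, Subset.rfl, hU, fun M' => ⟨M', by unfold scanStep; rw [if_neg hc], by simp⟩⟩

theorem staysIn_scanRow (h : ∀ y < k, n * x + y ∈ E → Covered n B S x y) :
    StaysIn B S (scanRow n B E x k) := by
  induction k with
  | zero => exact StaysIn.id
  | succ k ih =>
    have : scanRow n B E x (k + 1) = fun σ => scanStep n B E x k (scanRow n B E x k σ) :=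
      funext fun σ => scanRow_succ
    rw [this]
    exact (staysIn_scanStep (h k (by omega))).comp (ih fun y hy => h y (by omega))

theorem staysIn_scanRows (h : ∀ x < k, ∀ y < n, n * x + y ∈ E → Covered n B S x y) :
    StaysIn B S (scanRows n B E k) := by
  induction k with
  | zero => exact StaysIn.id
  | succ k ih =>
    have : scanRows n B E (k + 1) = fun σ => scanRow n B E k n (scanRows n B E k σ) :=
      funext fun σ => scanRows_succ
    rw [this]
    exact (staysIn_scanRow (h k (by omega))).comp (ih fun x hx => h x (by omega))

/-- A covering table of cliques is found by the scan with some small guess. -/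
theorem exists_isCliqueTable_scan (hB : 0 < B) (hS : IsCliqueTable n B t E S)
    (h : ∀ x < n, ∀ y < n, n * x + y ∈ E → Covered n B S x y) :
    ∃ N < B ^ t, IsCliqueTable n B t E (scan n B E N) := by
  obtain ⟨U, -, hU, hM⟩ := staysIn_scanRows (k := n) h ∅ (empty_subset _)
  -- Demanding that no guess remain turns the digit bound into `N + 1 ≤ B ^ #U`, and `U ⊆ S` has at
  -- most `t` cells.
  obtain ⟨N, e, hN⟩ := hM 0
  have hcard := (card_le_card hU).trans hS.1
  refine ⟨N, ?_, ?_⟩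
  · have : B ^ (#U - #(∅ : Finset ℕ)) ≤ B ^ t :=
      Nat.pow_le_pow_right hB ((Nat.sub_le _ _).trans hcard)
    omega
  · rw [scan, e]
    exact ⟨hcard, fun i h₁ h₂ x hx₀ hx y hy₀ hy hix hiy =>
      hS.2 i h₁ h₂ x hx₀ hx y hy₀ hy (hU hix) (hU hiy)⟩

end

/-! ### Tables and clique covers of the graph. -/

section

variable {n : ℕ} (G : SimpleGraph (Fin n))

/-- The nonzero cells of the adjacency matrix. -/
def edgeCells : Set ℕ := {a | ∃ x y : Fin n, G.Adj x y ∧ a = n * (x : ℕ) + (y : ℕ)}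

variable {G}

theorem cell_inj {i j x y : ℕ} (hx : x < n) (hy : y < n) (h : n * i + x = n * j + y) :
    i = j ∧ x = y := by
  have h₁ := congrArg (· / n) h
  have h₂ := congrArg (· % n) h
  simp only [Nat.mul_add_div (show 0 < n by omega), Nat.div_eq_of_lt hx, Nat.div_eq_of_lt hy,
    Nat.mul_add_mod, Nat.mod_eq_of_lt hx, Nat.mod_eq_of_lt hy] at h₁ h₂
  exact ⟨h₁, h₂⟩

theorem mem_edgeCells {x y : Fin n} : n * (x : ℕ) + y ∈ edgeCells G ↔ G.Adj x y := by
  refine ⟨fun ⟨x', y', h, e⟩ => ?_, fun h => ⟨x, y, h, rfl⟩⟩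
  obtain ⟨h₁, h₂⟩ := cell_inj y.2 y'.2 e
  rwa [Fin.ext h₁, Fin.ext h₂]

theorem lt_of_mem_edgeCells {a : ℕ} (h : a ∈ edgeCells G) : a < n * n := by
  obtain ⟨x, y, -, rfl⟩ := h
  exact (mem_Ico.1 (cell_mem_Ico y.2 (Nat.zero_le _) x.2)).2

/-- Equal rows merge in the image, which can only lower the total size; the pairs (row, vertex)
inject into the cells of `S`. -/
theorem isSolution_of_table {B t : ℕ} {S : Finset ℕ} (hS : IsCliqueTable n B t (edgeCells G) S)
    (h : ∀ x < n, ∀ y < n, n * x + y ∈ edgeCells G → Covered n B S x y) :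
    IsSolution G t ((range B).image fun i => univ.filter fun x : Fin n => n * (n + i) + x ∈ S) := by
  refine ⟨?_, ?_, ?_⟩
  · intro K hK x hx y hy hxy
    obtain ⟨i, hi, rfl⟩ := mem_image.1 hK
    have := mem_range.1 hi
    simp only [coe_filter, mem_univ, true_and, Set.mem_ofPred_eq] at hx hy
    exact mem_edgeCells.1 (hS.2 (n + i) (by omega) (by omega) x (Nat.zero_le _) x.2 y
      (Nat.zero_le _) y.2 hx hy fun h => hxy (Fin.ext h))
  · intro x y hxy
    obtain ⟨i, h₁, h₂, hx, hy⟩ := h x x.2 y y.2 (mem_edgeCells.2 hxy)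
    refine ⟨_, mem_image_of_mem _ (mem_range.2 (show i - n < B by omega)), ?_, ?_⟩ <;>
      simpa [show n + (i - n) = i by omega]
  · calc _ ≤ ∑ i ∈ range B, #(univ.filter fun x : Fin n => n * (n + i) + (x : ℕ) ∈ S) :=
          sum_image_le_of_nonneg (fun _ _ => Nat.zero_le _)
      _ = #((range B).sigma fun i => univ.filter fun x : Fin n => n * (n + i) + (x : ℕ) ∈ S) :=
          (card_sigma _ _).symm
      _ ≤ #S := by
          refine card_le_card_of_injOn (fun p => n * (n + p.1) + (p.2 : ℕ)) ?_ ?_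
          · rintro ⟨i, x⟩ h
            simp only [coe_sigma, Set.mem_sigma_iff, mem_coe, mem_filter] at h
            exact h.2.2
          · rintro ⟨i, x⟩ - ⟨j, y⟩ - e
            obtain ⟨h₁, h₂⟩ := cell_inj x.2 y.2 e
            obtain rfl : i = j := by simpa using h₁
            obtain rfl := Fin.ext h₂
            rfl
      _ ≤ t := hS.1

/-- Empty cliques are dropped first: they cost nothing and could exceed the number of rows. The
nonempty ones number at most the total size, hence at most `B`, and get distinct rows. -/
theorem exists_table {B t : ℕ} (hB : t ≤ B) {C : Finset (Finset (Fin n))} (h : IsSolution G t C) :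
    ∃ S, IsCliqueTable n B t (edgeCells G) S ∧
      ∀ x < n, ∀ y < n, n * x + y ∈ edgeCells G → Covered n B S x y := by
  obtain ⟨hcl, hcov, hsum⟩ := h
  set C' := C.filter (·.Nonempty) with hC'
  have hsum' : ∑ K ∈ C', #K ≤ t := (sum_le_sum_of_subset (filter_subset _ _)).trans hsum
  have hk : #C' ≤ t := by
    refine le_trans ?_ hsum'
    rw [card_eq_sum_ones]
    exact sum_le_sum fun K hK => card_pos.2 (mem_filter.1 hK).2
  set S : Finset ℕ :=
    C'.attach.biUnion fun K => K.1.image fun x : Fin n => n * (n + C'.equivFin K) + x with hS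
  have mem_S : ∀ i, ∀ x : Fin n, n * i + x ∈ S ↔ ∃ K : C', n + C'.equivFin K = i ∧ x ∈ K.1 := by
    intro i x
    simp only [hS, mem_biUnion, mem_attach, true_and, mem_image]
    refine exists_congr fun K => ⟨fun ⟨y, hy, e⟩ => ?_, fun ⟨e, hx⟩ => ⟨x, hx, by rw [e]⟩⟩
    obtain ⟨h₁, h₂⟩ := cell_inj y.2 x.2 e
    obtain rfl := Fin.ext h₂
    exact ⟨h₁, hy⟩
  refine ⟨S, ⟨?_, ?_⟩, ?_⟩
  · calc #S ≤ ∑ K ∈ C'.attach, #(K.1.image fun x : Fin n => n * (n + C'.equivFin K) + (x : ℕ)) :=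
          card_biUnion_le
      _ ≤ ∑ K ∈ C'.attach, #K.1 := sum_le_sum fun K _ => card_image_le
      _ = ∑ K ∈ C', #K := sum_attach C' fun K => #K
      _ ≤ t := hsum'
  · intro i _ _ x _ hx y _ hy hix hiy hxy
    obtain ⟨K, hK, hxK⟩ := (mem_S i ⟨x, hx⟩).1 hix
    obtain ⟨K', hK', hyK⟩ := (mem_S i ⟨y, hy⟩).1 hiy
    obtain rfl : K = K' := C'.equivFin.injective (Fin.ext (by omega))
    exact (mem_edgeCells (x := ⟨x, hx⟩) (y := ⟨y, hy⟩)).2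
      (hcl K.1 (mem_filter.1 K.2).1 hxK hyK fun e => hxy (congrArg Fin.val e))
  · intro x hx y hy hxy
    obtain ⟨K, hK, hxK, hyK⟩ := hcov ⟨x, hx⟩ ⟨y, hy⟩
      ((mem_edgeCells (x := ⟨x, hx⟩) (y := ⟨y, hy⟩)).1 hxy)
    have hK' : K ∈ C' := mem_filter.2 ⟨hK, ⟨_, hxK⟩⟩
    have := (C'.equivFin ⟨K, hK'⟩).2
    exact ⟨n + C'.equivFin ⟨K, hK'⟩, by omega, by omega,
      (mem_S _ ⟨x, hx⟩).2 ⟨⟨K, hK'⟩, rfl, hxK⟩, (mem_S _ ⟨y, hy⟩).2 ⟨⟨K, hK'⟩, rfl, hyK⟩⟩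

open Classical in
/-- The edges form a solution of size at most `n * n`. -/
theorem exists_isSolution_mul_self : ∃ C, IsSolution G (n * n) C := by
  refine ⟨G.edgeFinset.image Sym2.toFinset, ?_, ?_, ?_⟩
  · intro K hK
    obtain ⟨e, he, rfl⟩ := mem_image.1 hK
    induction e with | _ x y
    rw [SimpleGraph.mem_edgeFinset, SimpleGraph.mem_edgeSet] at he
    intro a ha b hb hab
    simp only [mem_coe, Sym2.mem_toFinset, Sym2.mem_iff] at ha hb
    obtain rfl | rfl := ha <;> obtain rfl | rfl := hb
    exacts [absurd rfl hab, he, he.symm, absurd rfl hab]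
  · intro x y hxy
    exact ⟨_, mem_image_of_mem _ (SimpleGraph.mem_edgeFinset.2 (G.mem_edgeSet.2 hxy)),
      by simp, by simp⟩
  · calc _ ≤ ∑ e ∈ G.edgeFinset, #e.toFinset := sum_image_le_of_nonneg (fun _ _ => Nat.zero_le _)
      _ ≤ ∑ e ∈ G.edgeFinset, 2 := by
          refine sum_le_sum fun e _ => ?_
          induction e with | _ x y
          rw [Sym2.toFinset_mk_eq]
          exact card_le_two
      _ = #G.edgeFinset * 2 := by simp
      _ ≤ n.choose 2 * 2 := by
          have := G.card_edgeFinset_le_card_choose_two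
          rw [Fintype.card_fin] at this
          exact Nat.mul_le_mul_right _ this
      _ ≤ n * n := by
          rw [Nat.choose_two_right]
          exact (Nat.div_mul_le_self _ _).trans (Nat.mul_le_mul_left _ (Nat.sub_le _ _))

/-- Allows the search to work with the capped bound without losing any solvable instance. -/
theorem exists_isSolution_min {t : ℕ} (h : ∃ C, IsSolution G t C) :
    ∃ C, IsSolution G (min t (n * n)) C := by
  rcases le_total t (n * n) with ht | ht
  · rwa [min_eq_left ht]
  · rw [min_eq_right ht]; exact exists_isSolution_mul_self

theorem IsSolution.mono {t t' : ℕ} {C : Finset (Finset (Fin n))} (h : IsSolution G t C)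
    (ht : t ≤ t') : IsSolution G t' C :=
  ⟨h.1, h.2.1, h.2.2.trans ht⟩

end

end AssignmentCliqueCover

/-! ### The program

Registers: `0` holds `n`; `1` the bound `t` on the total size; `2` and `3` the constants `0` and `1`;
`4` the number `B` of vertex sets in the table; `5`, `6`, `7` hold `n * n`, `n + B` and
`n * (n + B)`; `8` the number of guesses; `9` the current guess; `10` its remaining digits;
`11`, `12`, `13` two vertices and a row; `24` tells whether a solution has been found; the other
ones are auxiliary. -/

namespace AssignmentCliqueCover

open RAM RAM.Prog

/-- Load the cell in row `row` and column `col` into register `d`. -/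
def loadCell (d row col : ℕ) : Prog := .seq (.copy d col) (.seq (addMul d 0 row) (.load d d))

/-- Write `1` into the cell in row `row` and column `col`. -/
def markCell (row col : ℕ) : Prog := .seq (.copy 14 col) (.seq (addMul 14 0 row) (.store 14 3))

/-- Set register `18` to `1` if the pair in registers `11`, `12` is not covered, and to `0`
otherwise. -/
def testCovered : Prog :=
  .seq (.const 18 1) (forRange 13 0 6 (.seq (loadCell 14 13 11) (.seq (loadCell 15 13 12)
    (.cond (.lt 2 14) (.cond (.lt 2 15) (.const 18 0) .skip) .skip))))

/-- Divide register `10` by `B`; register `20` receives the row named by the remainder. -/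
def divide : Prog :=
  .seq (.const 19 0) (.seq (.copy 20 0) (.seq
    (forRange 21 2 10 (.seq (.inc 20) (.cond (.eq 20 6) (.seq (.copy 20 0) (.inc 19)) .skip)))
    (.copy 10 19)))

/-- The program for `scanStep`. -/
def scanStepProg : Prog :=
  .seq (loadCell 14 11 12) (.cond (.lt 2 14) (.seq testCovered (.cond (.lt 2 18)
    (.seq divide (.seq (markCell 20 11) (markCell 20 12))) .skip)) .skip)

/-- The program for `scan`, on a table that is empty. -/
def scanProg : Prog :=
  .seq (.copy 10 9) (forRange 11 2 0 (forRange 12 2 0 scanStepProg))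

/-- Clear the table. -/
def clear : Prog := forRange 25 5 7 (.store 25 2)

/-- Count the nonzero cells of the table in register `23`. -/
def weigh : Prog :=
  .seq (.const 23 0) (forRange 25 5 7 (.seq (.load 14 25) (.cond (.lt 2 14) (.inc 23) .skip)))

/-- Clear register `22` unless the vertex sets of the table are cliques. -/
def testCliques : Prog :=
  forRange 13 0 6 (forRange 11 2 0 (forRange 12 2 0 (.seq (loadCell 14 13 11)
    (.cond (.lt 2 14) (.seq (loadCell 15 13 12) (.cond (.lt 2 15) (.cond (.eq 11 12) .skip
      (.seq (loadCell 26 11 12) (.cond (.lt 2 26) .skip (.const 22 0)))) .skip)) .skip))))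

/-- Try one guess. -/
def tryGuess : Prog :=
  .seq clear (.seq scanProg (.seq (.const 22 1) (.seq weigh (.seq
    (.cond (.lt 1 23) (.const 22 0) .skip) (.seq testCliques (.copy 24 22))))))

/-- Compute the constants. -/
def prepare : Prog :=
  .seq (addMul 5 0 0) (.seq (.cond (.lt 5 1) (.copy 1 5) .skip) (.seq (.copy 4 1) (.seq
    (.cond (.lt 2 4) .skip (.inc 4)) (.seq (.const 3 1) (.seq (.copy 6 0) (.seq (addMul 6 4 3)
      (addMul 7 0 6)))))))

/-- Compute the number of guesses. -/
def countGuesses : Prog :=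
  .seq (.const 8 1) (forRange 21 2 1 (.seq (.const 26 0) (.seq (addMul 26 8 4) (.copy 8 26))))

/-- Copy the table to the beginning of the memory. -/
def copyTable : Prog :=
  .seq (.const 26 0) (forRange 25 5 7 (.seq (.load 14 25) (.seq (.store 26 14) (.inc 26))))

/-- The algorithm. -/
def solver : Prog :=
  .seq prepare (.seq countGuesses (.seq (forRange 9 2 8 (.cond (.lt 2 24) .skip tryGuess))
    (.seq copyTable (.seq (.copy 0 24) (.copy 1 4)))))

/-! ### Machine invariants and correctness of the subroutines. -/

/-- The constant registers have the right contents. -/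
structure Ctx (n t B : ℕ) (s : State) : Prop where
  reg0 : s.reg 0 = n
  reg1 : s.reg 1 = t
  reg2 : s.reg 2 = 0
  reg3 : s.reg 3 = 1
  reg4 : s.reg 4 = B
  reg5 : s.reg 5 = n * n
  reg6 : s.reg 6 = n + B
  reg7 : s.reg 7 = n * (n + B)

theorem Ctx.frame {n t B : ℕ} {s s' : State} {p : Prog} (h : Ctx n t B s) (hf : Frame p s s')
    (hp : ∀ r < 8, r ∉ p.writes) : Ctx n t B s' := by
  constructor
  · rw [hf.reg 0 (hp 0 (by omega)), h.reg0]
  · rw [hf.reg 1 (hp 1 (by omega)), h.reg1]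
  · rw [hf.reg 2 (hp 2 (by omega)), h.reg2]
  · rw [hf.reg 3 (hp 3 (by omega)), h.reg3]
  · rw [hf.reg 4 (hp 4 (by omega)), h.reg4]
  · rw [hf.reg 5 (hp 5 (by omega)), h.reg5]
  · rw [hf.reg 6 (hp 6 (by omega)), h.reg6]
  · rw [hf.reg 7 (hp 7 (by omega)), h.reg7]

/-- The memory holds the adjacency matrix `E` and the table `S`, in the right places. -/
structure Rep (n B : ℕ) (E : Set ℕ) (S : Finset ℕ) (s : State) : Prop where
  mem : ∀ a, s.mem a ≠ 0 ↔ a ∈ E ∨ a ∈ S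
  edges : ∀ a ∈ E, a < n * n
  table : S ⊆ Finset.Ico (n * n) (n * (n + B))

section

variable {n t B : ℕ} {E : Set ℕ} {S : Finset ℕ} {s s' : State}

theorem Rep.congr (h : Rep n B E S s) (hm : s'.mem = s.mem) : Rep n B E S s' :=
  ⟨fun a => by rw [hm, h.mem], h.edges, h.table⟩

/-- Matrix cells lie below `n * n` and table cells do not, so one memory serves both without
interference. -/
theorem Rep.table_iff (h : Rep n B E S s) {a : ℕ} (ha : n * n ≤ a) : s.mem a ≠ 0 ↔ a ∈ S := by
  rw [h.mem]
  refine or_iff_right fun h' => ?_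
  have := h.edges a h'
  omega

theorem Rep.row_iff (h : Rep n B E S s) {i x : ℕ} (hi : n ≤ i) :
    s.mem (n * i + x) ≠ 0 ↔ n * i + x ∈ S :=
  h.table_iff ((Nat.mul_le_mul_left n hi).trans (Nat.le_add_right _ _))

theorem Rep.edge_iff (h : Rep n B E S s) {x y : ℕ} (hx : x < n) (hy : y < n) :
    s.mem (n * x + y) ≠ 0 ↔ n * x + y ∈ E := by
  rw [h.mem]
  refine or_iff_left fun h' => ?_
  have := Finset.mem_Ico.1 (h.table h')
  have := Finset.mem_Ico.1 (cell_mem_Ico hy (Nat.zero_le _) hx)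
  omega

/-- The time to access a cell. -/
def cellCost (n h : ℕ) : ℕ := 4 + n * (4 + 3 * h)

theorem does_loadCell {d row col h r c : ℕ} (h0 : s.reg 0 = n) (h2 : s.reg 2 = 0)
    (hrow : s.reg row = r) (hr : r ≤ h) (hcol : s.reg col = c)
    (hd : d ∉ [0, row, 2, 16, 17]) (hrow' : row ∉ [16, 17]) :
    Does (loadCell d row col) s (cellCost n h) fun s' => s'.reg d = s.mem (n * r + c) := by
  have hd' := hd
  simp only [List.mem_cons, List.not_mem_nil, or_false, not_or] at hd'
  refine (Does.seq (Q := fun s' => s' = s.setReg d c) (Does.copy (by rw [hcol])) ?_).le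
    (T := 1 + ((2 + n * (4 + 3 * r)) + 1)) ?_
  · rintro s₁ - rfl
    have := Does.addMul (s := s.setReg d c) (d := d) (a := 0) (b := row)
      (by simp [Ne.symm hd'.2.2.1, h2]) hd (by simp) hrow'
    simp only [State.setReg_reg, Ne.symm hd'.1, Ne.symm hd'.2.1, if_false, if_true, h0, hrow]
      at this
    refine this.seq fun s₂ hf h => Does.load ?_
    have hm : s₂.mem = s.mem := hf.mem rfl
    simp [h, hm, add_comm]
  · have : n * (4 + 3 * r) ≤ n * (4 + 3 * h) := Nat.mul_le_mul_left _ (by omega)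
    unfold cellCost
    omega

theorem does_markCell {row col h r c : ℕ} (h0 : s.reg 0 = n) (h2 : s.reg 2 = 0)
    (h3 : s.reg 3 = 1) (hrow : s.reg row = r) (hr : r ≤ h) (hcol : s.reg col = c)
    (hrow' : row ∉ [14, 16, 17]) :
    Does (markCell row col) s (cellCost n h) fun s' =>
      ∀ a, s'.mem a ≠ 0 ↔ a = n * r + c ∨ s.mem a ≠ 0 := by
  simp only [List.mem_cons, List.not_mem_nil, or_false, not_or] at hrow'
  refine (Does.seq (Q := fun s' => s' = s.setReg 14 c) (Does.copy (by rw [hcol])) ?_).le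
    (T := 1 + ((2 + n * (4 + 3 * r)) + 1)) ?_
  · rintro s₁ - rfl
    have := Does.addMul (s := s.setReg 14 c) (d := 14) (a := 0) (b := row)
      (by simp [h2]) (by simp [Ne.symm hrow'.1]) (by simp) (by simp [hrow'])
    simp only [State.setReg_reg, hrow'.1, if_false, if_true, h0, hrow] at this
    refine this.seq fun s₂ hf h => Does.store ?_
    have hm : s₂.mem = s.mem := hf.mem rfl
    have hr : s₂.reg 3 = 1 := by rw [hf.reg 3 (by simp [addMul, RAM.forRange, writes])]; simp [h3]
    intro a
    simp only [State.setMem_mem, hm, hr]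
    rw [show s₂.reg 14 = n * r + c by simpa [h0, add_comm] using h]
    split_ifs with ha <;> simp [ha]
  · have : n * (4 + 3 * r) ≤ n * (4 + 3 * h) := Nat.mul_le_mul_left _ (by omega)
    unfold cellCost
    omega

theorem does_testCovered {x y : ℕ} (hc : Ctx n t B s) (hr : Rep n B E S s)
    (hx : s.reg 11 = x) (hy : s.reg 12 = y) :
    Does testCovered s (3 + B * (2 * cellCost n (n + B) + 5)) fun s' =>
      s'.reg 18 ≠ 0 ↔ ¬ Covered n B S x y := by
  refine (Does.seq (Q := fun s' => s' = s.setReg 18 1) (Does.const rfl) ?_).le (T := 1 +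
    (2 + (n + B - n) * ((cellCost n (n + B) + (cellCost n (n + B) + 3)) + 2))) ?_
  · rintro s₁ hf rfl
    refine (Does.forRange_flag (a := n) (b := n + B) (f := 18)
      (fun i => ¬ (n * i + x ∈ S ∧ n * i + y ∈ S)) (by decide) (by decide) (by decide) (by decide)
      (hc.frame hf (by decide)).reg0 (hc.frame hf (by decide)).reg6 (by omega) ?_).imp ?_
    · intro i s₂ hi hiB hi' hf₂
      have hc₂ := (hc.frame hf (by decide)).frame hf₂ (by decide)
      have hr₂ : Rep n B E S s₂ := (hr.congr (hf.mem rfl)).congr (hf₂.mem rfl)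
      have hx₂ : s₂.reg 11 = x := by rw [hf₂.reg 11 (by decide), hf.reg 11 (by decide), hx]
      have hy₂ : s₂.reg 12 = y := by rw [hf₂.reg 12 (by decide), hf.reg 12 (by decide), hy]
      refine (does_loadCell hc₂.reg0 hc₂.reg2 hi' hiB.le hx₂ (by decide) (by decide)).seq
        fun s₃ hf₃ h₃ => ?_
      have hc₃ := hc₂.frame hf₃ (by decide)
      refine (does_loadCell (r := i) (c := y) hc₃.reg0 hc₃.reg2
        (by rw [hf₃.reg 13 (by decide), hi']) hiB.le (by rw [hf₃.reg 12 (by decide), hy₂])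
        (by decide) (by decide)).seq fun s₄ hf₄ h₄ => ?_
      have hc₄ := hc₃.frame hf₄ (by decide)
      have h18 : s₄.reg 18 = s₂.reg 18 := by
        rw [hf₄.reg 18 (by decide), hf₃.reg 18 (by decide)]
      have e₁ : 0 < s₄.reg 14 ↔ n * i + x ∈ S := by
        rw [hf₄.reg 14 (by decide), h₃, Nat.pos_iff_ne_zero, hr₂.row_iff hi]
      have e₂ : 0 < s₄.reg 15 ↔ n * i + y ∈ S := by
        rw [h₄, hf₃.mem rfl, Nat.pos_iff_ne_zero, hr₂.row_iff hi]
      refine Does.cond (T := 2) (fun h => Does.cond (T := 1) (fun h' => Does.const ?_)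
        fun h' => Does.skip ?_) fun h => (Does.skip ?_).le (by omega)
      all_goals simp only [Test.Holds, hc₄.reg2, e₁, e₂] at *
      · simp [h, h']
      · simp [h18, h, h']
      · simp [h18, h]
    · intro s₂ _ h
      rw [h]
      simp only [State.setReg_reg, if_true, Covered]
      constructor
      · rintro ⟨-, h⟩ ⟨i, h₁, h₂, h₃⟩
        exact h i h₁ h₂ h₃
      · exact fun h => ⟨one_ne_zero, fun i h₁ h₂ h₃ => h ⟨i, h₁, h₂, h₃⟩⟩
  · rw [Nat.add_sub_cancel_left, ← add_assoc, ← add_assoc, ← two_mul]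

/-- Count to `M` with a counter that wraps around every `B` rounds: register `19` holds the quotient
so far and register `20` the remainder, shifted by `n` so as to be a row number. The linear cost in
`M` is the source of the second factor `B ^ t` in the running time. -/
theorem does_divide {M : ℕ} (hc : Ctx n t B s) (hB : 0 < B) (hM : s.reg 10 = M) :
    Does divide s (5 + M * 6) fun s' => s'.reg 10 = M / B ∧ s'.reg 20 = n + M % B := by
  refine (Does.seq (T := 1) (T' := 1 + ((2 + (M - 0) * (4 + 2)) + 1))
    (Q := fun s' => s' = s.setReg 19 0) (Does.const rfl) ?_).le (by omega)
  rintro s₁ - rfl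
  refine Does.seq (Q := fun s' => s' = (s.setReg 19 0).setReg 20 n)
    (Does.copy (by simp [hc.reg0])) ?_
  rintro s₂ - rfl
  refine (Does.forRange (a := 0) (b := M) (fun k s' => ∃ r, s'.reg 20 = n + r ∧ r < B ∧
    s'.reg 19 * B + r = k) (by decide) (by decide) (by decide) (by simp [hc.reg2]) (by simp [hM])
    (Nat.zero_le _) ⟨0, by simp [hB]⟩ ?_).seq ?_
  · intro k s₃ _ _ _ hf ⟨r, hr, hrB, hk⟩
    refine Does.seq (T := 1) (T' := 1 + 2) (Q := fun s' => s' = s₃.setReg 20 (n + r + 1))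
      (Does.inc (by rw [hr])) ?_
    rintro s₄ - rfl
    have h6 : s₃.reg 6 = n + B := by rw [hf.reg 6 (by decide)]; simp [hc.reg6]
    have h0 : s₃.reg 0 = n := by rw [hf.reg 0 (by decide)]; simp [hc.reg0]
    refine Does.cond (T := 2) (fun h => ?_) fun h => (Does.skip ⟨r + 1, ?_⟩).le (by omega)
    · simp [Test.Holds, h6] at h
      refine Does.seq (T := 1) (T' := 1)
        (Q := fun s' => s' = (s₃.setReg 20 (n + r + 1)).setReg 20 n)
        (Does.copy (by simp [h0])) ?_
      rintro s₅ - rfl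
      refine Does.inc ⟨0, by simp, hB, ?_⟩
      simp [Nat.succ_mul]
      omega
    · simp [Test.Holds, h6] at h
      simp
      omega
  · rintro s₃ hf ⟨r, hr, hrB, hk⟩
    refine Does.copy ⟨?_, ?_⟩
    · simp only [State.setReg_reg, if_true]
      rw [← hk, mul_comm, Nat.mul_add_div hB, Nat.div_eq_of_lt hrB, add_zero]
    · simp only [State.setReg_reg]
      rw [if_neg (by decide), hr, ← hk, mul_comm, Nat.mul_add_mod, Nat.mod_eq_of_lt hrB]

/-- The time for one step of the scan with a guess up to `L`. -/
def stepCost (n B L : ℕ) : ℕ :=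
  cellCost n (n + B) + (1 + ((3 + B * (2 * cellCost n (n + B) + 5)) +
    (1 + ((5 + L * 6) + (cellCost n (n + B) + cellCost n (n + B))))))

theorem does_scanStepProg {x y L : ℕ} {σ : ℕ × Finset ℕ} (hc : Ctx n t B s) (hB : 0 < B)
    (hr : Rep n B E σ.2 s) (hM : s.reg 10 = σ.1) (hL : σ.1 ≤ L) (hx : s.reg 11 = x) (hxn : x < n)
    (hy : s.reg 12 = y) (hyn : y < n) :
    Does scanStepProg s (stepCost n B L) fun s' =>
      s'.reg 10 = (scanStep n B E x y σ).1 ∧ Rep n B E (scanStep n B E x y σ).2 s' := by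
  refine (does_loadCell hc.reg0 hc.reg2 hx (by omega) hy (by decide) (by decide)).seq
    fun s₁ hf₁ h₁ => ?_
  have hc₁ := hc.frame hf₁ (by decide)
  have hr₁ : Rep n B E σ.2 s₁ := hr.congr (hf₁.mem rfl)
  have e₁ : 0 < s₁.reg 14 ↔ n * x + y ∈ E := by
    rw [h₁, Nat.pos_iff_ne_zero, hr.edge_iff hxn hyn]
  have hM₁ : s₁.reg 10 = σ.1 := by rw [hf₁.reg 10 (by decide), hM]
  have hx₁ : s₁.reg 11 = x := by rw [hf₁.reg 11 (by decide), hx]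
  have hy₁ : s₁.reg 12 = y := by rw [hf₁.reg 12 (by decide), hy]
  refine Does.cond (fun h => (does_testCovered hc₁ hr₁ hx₁ hy₁).seq fun s₂ hf₂ h₂ => ?_)
    fun h => (Does.skip ?_).le (by omega)
  · simp only [Test.Holds, hc₁.reg2, e₁] at h
    have hc₂ := hc₁.frame hf₂ (by decide)
    have hr₂ : Rep n B E σ.2 s₂ := hr₁.congr (hf₂.mem rfl)
    have hM₂ : s₂.reg 10 = σ.1 := by rw [hf₂.reg 10 (by decide), hM₁]
    refine Does.cond (fun h' => ?_) fun h' => (Does.skip ?_).le (by omega)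
    all_goals simp only [Test.Holds, hc₂.reg2, Nat.pos_iff_ne_zero, h₂] at h'
    · rw [scanStep, if_pos ⟨h, h'⟩]
      refine ((does_divide hc₂ hB hM₂).le (by omega)).seq fun s₃ hf₃ h₃ => ?_
      have hc₃ := hc₂.frame hf₃ (by decide)
      have hmod := Nat.mod_lt σ.1 hB
      refine (does_markCell hc₃.reg0 hc₃.reg2 hc₃.reg3 h₃.2 (h := n + B) (c := x) (by omega)
        (by rw [hf₃.reg 11 (by decide), hf₂.reg 11 (by decide), hx₁]) (by decide)).seq
        fun s₄ hf₄ h₄ => ?_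
      have hc₄ := hc₃.frame hf₄ (by decide)
      refine (does_markCell hc₄.reg0 hc₄.reg2 hc₄.reg3 (r := n + σ.1 % B)
        (by rw [hf₄.reg 20 (by decide), h₃.2]) (h := n + B) (c := y) (by omega)
        (by rw [hf₄.reg 12 (by decide), hf₃.reg 12 (by decide), hf₂.reg 12 (by decide), hy₁])
        (by decide)).imp fun s₅ hf₅ h₅ => ⟨?_, ?_, hr.edges, ?_⟩
      · rw [hf₅.reg 10 (by decide), hf₄.reg 10 (by decide), h₃.1]
      · intro a
        rw [h₅, h₄, hf₃.mem rfl, hr₂.mem]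
        simp only [Finset.mem_insert]
        tauto
      · exact Finset.insert_subset (cell_mem_Ico hyn (by omega) (by omega))
          (Finset.insert_subset (cell_mem_Ico hxn (by omega) (by omega)) hr.table)
    · rw [scanStep, if_neg fun h => h' h.2]
      exact ⟨hM₂, hr₂⟩
  · simp only [Test.Holds, hc₁.reg2, e₁] at h
    rw [scanStep, if_neg fun h' => h h'.1]
    exact ⟨hM₁, hr₁⟩

/-- The remaining guess never grows, so a bound on the initial guess bounds the cost of every
division in the scan. -/
theorem scanStep_fst_le {x y : ℕ} {σ : ℕ × Finset ℕ} : (scanStep n B E x y σ).1 ≤ σ.1 := by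
  unfold scanStep
  split_ifs
  · exact Nat.div_le_self _ _
  · exact le_rfl

theorem scanRow_fst_le {x k : ℕ} {σ : ℕ × Finset ℕ} : (scanRow n B E x k σ).1 ≤ σ.1 := by
  induction k with
  | zero => exact le_rfl
  | succ k ih => rw [scanRow_succ]; exact scanStep_fst_le.trans ih

theorem scanRows_fst_le {k : ℕ} {σ : ℕ × Finset ℕ} : (scanRows n B E k σ).1 ≤ σ.1 := by
  induction k with
  | zero => exact le_rfl
  | succ k ih => rw [scanRows_succ]; exact scanRow_fst_le.trans ih

/-- The time for the scan with a guess up to `L`. -/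
def scanCost (n B L : ℕ) : ℕ := 1 + (2 + n * ((2 + n * (stepCost n B L + 2)) + 2))

theorem does_scanProg {N L : ℕ} (hc : Ctx n t B s) (hB : 0 < B) (hr : Rep n B E ∅ s)
    (hN : s.reg 9 = N)
    (hL : N ≤ L) : Does scanProg s (scanCost n B L) fun s' => Rep n B E (scan n B E N) s' := by
  refine Does.seq (Q := fun s' => s' = s.setReg 10 N) (Does.copy (by rw [hN])) ?_
  rintro s₁ hf₁ rfl
  have hc₁ := hc.frame hf₁ (by decide)
  refine (Does.forRange (a := 0) (b := n) (fun x s' =>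
    s'.reg 10 = (scanRows n B E x (N, ∅)).1 ∧ Rep n B E (scanRows n B E x (N, ∅)).2 s')
    (by decide) (by decide) (by decide) hc₁.reg2 hc₁.reg0 (Nat.zero_le _) ?_ ?_).imp ?_
  · exact ⟨by simp [scanRows], hr.congr rfl⟩
  · intro x s₂ _ hx hx' hf₂ ⟨hM₂, hr₂⟩
    have hc₂ := hc₁.frame hf₂ (by decide)
    refine (Does.forRange (a := 0) (b := n) (fun y s' =>
      s'.reg 10 = (scanRow n B E x y (scanRows n B E x (N, ∅))).1 ∧
        Rep n B E (scanRow n B E x y (scanRows n B E x (N, ∅))).2 s')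
      (by decide) (by decide) (by decide) hc₂.reg2 hc₂.reg0 (Nat.zero_le _) ?_ ?_).imp ?_
    · exact ⟨by simp [scanRow, hM₂], hr₂.congr rfl⟩
    · intro y s₃ _ hy hy' hf₃ ⟨hM₃, hr₃⟩
      have hc₃ := hc₂.frame hf₃ (by decide)
      refine (does_scanStepProg hc₃ hB hr₃ hM₃ 
        ((scanRow_fst_le.trans scanRows_fst_le).trans hL)
        (by rw [hf₃.reg 11 (by decide), hx']) hx hy' hy).imp fun s₄ _ h => ?_
      rw [scanRow_succ]
      exact ⟨by simp [h.1], h.2.congr rfl⟩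
    · intro s₃ _ h
      rw [scanRows_succ]
      exact ⟨by simp [h.1], h.2.congr rfl⟩
  · exact fun _ _ h => h.2

theorem does_clear (hc : Ctx n t B s) (hr : Rep n B E S s) :
    Does clear s (2 + n * B * 3) fun s' => Rep n B E ∅ s' := by
  have hmul : n * (n + B) = n * n + n * B := Nat.mul_add _ _ _
  refine ((Does.forRange (a := n * n) (b := n * (n + B)) (T := 1)
    (fun k s' => ∀ a, s'.mem a = if n * n ≤ a ∧ a < k then 0 else s.mem a)
    (by decide) (by decide) (by decide) hc.reg5 hc.reg7 (by omega) ?_ ?_).mono ?_ ?_)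
  · intro a
    simp only [State.setReg_mem]
    rw [if_neg (by omega)]
  · intro k s₁ h₁ _ hk hf h
    have hc₁ := hc.frame hf (by decide)
    refine Does.store fun a => ?_
    simp only [State.setReg_mem, State.setMem_mem, hk, hc₁.reg2, h a]
    split_ifs <;> first | rfl | omega
  · rw [hmul, Nat.add_sub_cancel_left]
  · intro s₁ _ h
    refine ⟨fun a => ?_, hr.edges, Finset.empty_subset _⟩
    rw [h a]
    split_ifs with ha
    · simp only [ne_eq, not_true, Finset.notMem_empty, or_false, false_iff]
      intro h'
      have := hr.edges a h'
      omega
    · rw [hr.mem]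
      simp only [Finset.notMem_empty, or_false]
      exact or_iff_left fun h' => ha (Finset.mem_Ico.1 (hr.table h'))

theorem does_weigh (hc : Ctx n t B s) (hr : Rep n B E S s) :
    Does weigh s (3 + n * B * 5) fun s' => s'.reg 23 = S.card := by
  have hmul : n * (n + B) = n * n + n * B := Nat.mul_add _ _ _
  refine (Does.seq (T := 1) (T' := 2 + (n * (n + B) - n * n) * (3 + 2))
    (Q := fun s' => s' = s.setReg 23 0) (Does.const rfl) ?_).le ?_
  · rintro s₁ hf₁ rfl
    have hc₁ := hc.frame hf₁ (by decide)
    refine (Does.forRange (a := n * n) (b := n * (n + B)) (T := 3)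
      (fun k s' => s'.reg 23 = (S.filter (· < k)).card)
      (by decide) (by decide) (by decide) hc₁.reg5 hc₁.reg7 (by omega) ?_ ?_).imp ?_
    · symm
      simp only [State.setReg_reg]
      rw [if_neg (by decide), if_pos trivial, Finset.card_eq_zero, Finset.filter_eq_empty_iff]
      intro a ha
      have := Finset.mem_Ico.1 (hr.table ha)
      omega
    · intro k s₂ hk _ hk' hf₂ h
      have hc₂ := hc₁.frame hf₂ (by decide)
      have hr₂ : Rep n B E S s₂ := (hr.congr (hf₁.mem rfl)).congr (hf₂.mem rfl)
      refine Does.seq (T := 1) (T' := 2) (Q := fun s' => s' = s₂.setReg 14 (s₂.mem k))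
        (Does.load (by rw [hk'])) ?_
      rintro s₃ - rfl
      have e : S.filter (· < k + 1) = S.filter (· < k) ∪ S.filter (· = k) := by
        ext a
        simp only [Finset.mem_filter, Finset.mem_union, Nat.lt_succ_iff_lt_or_eq]
        tauto
      have hd : Disjoint (S.filter (· < k)) (S.filter (· = k)) :=
        Finset.disjoint_filter.2 fun a _ h h' => by omega
      refine Does.cond (T := 1) (fun h' => Does.inc ?_) fun h' => Does.skip ?_
      all_goals
        simp only [Test.Holds, State.setReg_reg, if_true, hc₂.reg2, Nat.pos_iff_ne_zero,
          hr₂.table_iff hk, reduceIte, Nat.reduceEqDiff, h] at h' ⊢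
        rw [e, Finset.card_union_of_disjoint hd, Finset.filter_eq']
        simp [h']
    · intro s₂ _ h
      rw [h, Finset.filter_true_of_mem]
      exact fun a ha => (Finset.mem_Ico.1 (hr.table ha)).2
  · rw [hmul, Nat.add_sub_cancel_left]
    omega

/-- The time to test whether the vertex sets of the table are cliques. -/
def cliquesCost (n B : ℕ) : ℕ :=
  2 + B * ((2 + n * ((2 + n * ((cellCost n (n + B) + (1 + (cellCost n (n + B) + (1 + (1 +
    (cellCost n (n + B) + 2)))))) + 2)) + 2)) + 2)

theorem does_testCliques (hc : Ctx n t B s) (hr : Rep n B E S s) :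
    Does testCliques s (cliquesCost n B) fun s' => s'.reg 22 ≠ 0 ↔ s.reg 22 ≠ 0 ∧
      ∀ i, n ≤ i → i < n + B → ∀ x, 0 ≤ x → x < n → ∀ y, 0 ≤ y → y < n →
        n * i + x ∈ S → n * i + y ∈ S → x ≠ y → n * x + y ∈ E := by
  have h := Does.forRange_flag (s := s) (i := 13) (lo := 0) (hi := 6) (a := n) (b := n + B)
    (f := 22) (T := 2 + n * ((2 + n * ((cellCost n (n + B) + (1 + (cellCost n (n + B) + (1 + (1 +
      (cellCost n (n + B) + 2)))))) + 2)) + 2))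
    (fun i => ∀ x, 0 ≤ x → x < n → ∀ y, 0 ≤ y → y < n →
      n * i + x ∈ S → n * i + y ∈ S → x ≠ y → n * x + y ∈ E)
    (p := forRange 11 2 0 (forRange 12 2 0 (.seq (loadCell 14 13 11)
      (.cond (.lt 2 14) (.seq (loadCell 15 13 12) (.cond (.lt 2 15) (.cond (.eq 11 12) .skip
        (.seq (loadCell 26 11 12) (.cond (.lt 2 26) .skip (.const 22 0)))) .skip)) .skip))))
    (by decide) (by decide) (by decide) (by decide) hc.reg0 hc.reg6 (by omega) ?_
  · rwa [Nat.add_sub_cancel_left] at h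
  intro i s₁ hi hiB hi' hf₁
  have hc₁ := hc.frame hf₁ (by decide)
  -- The predicate is found by unification: the outer one already has the shape produced by the
  -- inner loops, trivial bounds `0 ≤ x` and `0 ≤ y` included.
  refine Does.forRange_flag (a := 0) (b := n) _ (by decide) (by decide) (by decide) (by decide)
    hc₁.reg2 hc₁.reg0 (Nat.zero_le _) ?_
  intro x s₂ _ hx hx' hf₂
  have hc₂ := hc₁.frame hf₂ (by decide)
  refine Does.forRange_flag (a := 0) (b := n) _ (by decide) (by decide) (by decide) (by decide)
    hc₂.reg2 hc₂.reg0 (Nat.zero_le _) ?_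
  intro y s₃ _ hy hy' hf₃
  have hc₃ := hc₂.frame hf₃ (by decide)
  have hr₃ : Rep n B E S s₃ :=
    ((hr.congr (hf₁.mem rfl)).congr (hf₂.mem rfl)).congr (hf₃.mem rfl)
  have hi₃ : s₃.reg 13 = i := by rw [hf₃.reg 13 (by decide), hf₂.reg 13 (by decide), hi']
  have hx₃ : s₃.reg 11 = x := by rw [hf₃.reg 11 (by decide), hx']
  refine (does_loadCell hc₃.reg0 hc₃.reg2 hi₃ hiB.le hx₃ (by decide) (by decide)).seq
    fun s₄ hf₄ h₄ => ?_
  have hc₄ := hc₃.frame hf₄ (by decide)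
  rw [← Nat.pos_iff_ne_zero] at *
  have e₄ : 0 < s₄.reg 14 ↔ n * i + x ∈ S := by rw [h₄, Nat.pos_iff_ne_zero, hr₃.row_iff hi]
  have h22₄ : s₄.reg 22 = s₃.reg 22 := hf₄.reg 22 (by decide)
  refine Does.cond (fun h => ?_) fun h => (Does.skip ?_).le (by omega)
  all_goals simp only [Test.Holds, hc₄.reg2, e₄] at h
  swap
  · simp [h, h22₄]
  refine (does_loadCell (r := i) (c := y) hc₄.reg0 hc₄.reg2 (by rw [hf₄.reg 13 (by decide), hi₃])
    hiB.le (by rw [hf₄.reg 12 (by decide), hy']) (by decide) (by decide)).seq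
    fun s₅ hf₅ h₅ => ?_
  have hc₅ := hc₄.frame hf₅ (by decide)
  have e₅ : 0 < s₅.reg 15 ↔ n * i + y ∈ S := by
    rw [h₅, hf₄.mem rfl, Nat.pos_iff_ne_zero, hr₃.row_iff hi]
  have h22₅ : s₅.reg 22 = s₃.reg 22 := by rw [hf₅.reg 22 (by decide), h22₄]
  refine Does.cond (fun h' => ?_) fun h' => (Does.skip ?_).le (by omega)
  all_goals simp only [Test.Holds, hc₅.reg2, e₅] at h'
  swap
  · simp [h', h22₅]
  have hx₅ : s₅.reg 11 = x := by rw [hf₅.reg 11 (by decide), hf₄.reg 11 (by decide), hx₃]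
  have hy₅ : s₅.reg 12 = y := by rw [hf₅.reg 12 (by decide), hf₄.reg 12 (by decide), hy']
  refine Does.cond (fun h'' => (Does.skip ?_).le (by omega)) fun h'' => ?_
  all_goals simp only [Test.Holds, hx₅, hy₅] at h''
  · simp [h'', h22₅]
  refine (does_loadCell hc₅.reg0 hc₅.reg2 hx₅ (by omega) hy₅ (by decide) (by decide)).seq
    fun s₆ hf₆ h₆ => ?_
  have hc₆ := hc₅.frame hf₆ (by decide)
  have e₆ : 0 < s₆.reg 26 ↔ n * x + y ∈ E := by
    rw [h₆, hf₅.mem rfl, hf₄.mem rfl, Nat.pos_iff_ne_zero, hr₃.edge_iff hx hy]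
  have h22₆ : s₆.reg 22 = s₃.reg 22 := by rw [hf₆.reg 22 (by decide), h22₅]
  refine Does.cond (T := 1) (fun h => Does.skip ?_) fun h => Does.const ?_
  all_goals simp only [Test.Holds, hc₆.reg2, e₆] at h
  · simp [h, h22₆]
  · simp [*]

end

end AssignmentCliqueCover

/-! ### Correctness of the whole search. -/

namespace AssignmentCliqueCover

open RAM RAM.Prog

section

variable {n t B : ℕ} {E : Set ℕ} {S : Finset ℕ} {s s' : State}

/-- The time to try a guess up to `L`. -/
def tryCost (n B L : ℕ) : ℕ :=
  (2 + n * B * 3) + (scanCost n B L + (1 + ((3 + n * B * 5) + (2 + (cliquesCost n B + 1)))))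

theorem does_tryGuess {N L : ℕ} (hc : Ctx n t B s) (hB : 0 < B) (hr : Rep n B E S s)
    (hN : s.reg 9 = N) (hL : N ≤ L) :
    Does tryGuess s (tryCost n B L) fun s' => Rep n B E (scan n B E N) s' ∧
      (s'.reg 24 ≠ 0 ↔ IsCliqueTable n B t E (scan n B E N)) := by
  refine (does_clear hc hr).seq fun s₁ hf₁ hr₁ => ?_
  have hc₁ := hc.frame hf₁ (by decide)
  refine (does_scanProg hc₁ hB hr₁ (by rw [hf₁.reg 9 (by decide), hN]) hL).seq
    fun s₂ hf₂ hr₂ => ?_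
  have hc₂ := hc₁.frame hf₂ (by decide)
  refine Does.seq (Q := fun s' => s' = s₂.setReg 22 1) (Does.const rfl) ?_
  rintro s₃ hf₃ rfl
  have hc₃ := hc₂.frame hf₃ (by decide)
  refine (does_weigh hc₃ (hr₂.congr rfl)).seq fun s₄ hf₄ h₄ => ?_
  have hc₄ := hc₃.frame hf₄ (by decide)
  have h22₄ : s₄.reg 22 = 1 := by rw [hf₄.reg 22 (by decide)]; rfl
  refine Does.seq (Q := fun s' => s'.reg 22 ≠ 0 ↔ (scan n B E N).card ≤ t)
    (Does.cond (T := 1) (fun h => Does.const ?_) fun h => Does.skip ?_) fun s₅ hf₅ h₅ => ?_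
  · simp only [Test.Holds, hc₄.reg1, h₄] at h
    simpa using h
  · simp only [Test.Holds, hc₄.reg1, h₄] at h
    simpa [h22₄] using h
  have hc₅ := hc₄.frame hf₅ (by decide)
  have hr₅ : Rep n B E (scan n B E N) s₅ := ((hr₂.congr rfl).congr (hf₄.mem rfl)).congr (hf₅.mem rfl)
  refine (does_testCliques hc₅ hr₅).seq fun s₆ hf₆ h₆ => Does.copy ⟨hr₅.congr (hf₆.mem rfl), ?_⟩
  simp only [State.setReg_reg, if_true]
  rw [h₆, h₅, IsCliqueTable]

theorem does_prepare (h0 : s.reg 0 = n) (h1 : s.reg 1 = t) (h : ∀ r, 2 ≤ r → s.reg r = 0)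
    (hB : B = max (min t (n * n)) 1) :
    Does prepare s (15 + n * (4 + 3 * n) + B * 7 + n * (4 + 3 * (n + B)))
      (Ctx n (min t (n * n)) B) := by
  refine Does.le (T := (2 + n * (4 + 3 * n)) + ((1 + 1) + (1 + ((1 + 1) + (1 + (1 +
    ((2 + B * (4 + 3 * 1)) + (2 + n * (4 + 3 * (n + B)))))))))) ?_ (by omega)
  have := Does.addMul (s := s) (d := 5) (a := 0) (b := 0) (h 2 le_rfl) (by decide) (by decide)
    (by decide)
  rw [h0, h 5 (by omega), zero_add] at this
  refine this.seq fun s₁ hf₁ h₁ => ?_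
  have h0₁ : s₁.reg 0 = n := by rw [hf₁.reg 0 (by decide), h0]
  have h1₁ : s₁.reg 1 = t := by rw [hf₁.reg 1 (by decide), h1]
  refine Does.seq (Q := fun s' => s'.reg 1 = min t (n * n))
    (Does.cond (T := 1) (fun h => Does.copy ?_) fun h => Does.skip ?_) fun s₂ hf₂ h₂ => ?_
  · simp only [Test.Holds, h1₁, h₁] at h
    simp [h₁, h.le]
  · simp only [Test.Holds, h1₁, h₁, not_lt] at h
    simp [h1₁, h]
  refine Does.seq (Q := fun s' => s' = s₂.setReg 4 (min t (n * n)))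
    (Does.copy (by rw [h₂])) ?_
  rintro s₃ hf₃ rfl
  have h2₃ : (s₂.setReg 4 (min t (n * n))).reg 2 = 0 := by
    rw [hf₃.reg 2 (by decide), hf₂.reg 2 (by decide), hf₁.reg 2 (by decide), h 2 (by omega)]
  refine Does.seq (Q := fun s' => s'.reg 4 = B)
    (Does.cond (T := 1) (fun h => Does.skip ?_) fun h => Does.inc ?_) fun s₄ hf₄ h₄ => ?_
  · simp only [Test.Holds, h2₃] at h
    simp only [State.setReg_reg, if_true] at h ⊢
    omega
  · simp only [Test.Holds, h2₃] at h
    simp only [State.setReg_reg, if_true] at h ⊢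
    omega
  refine Does.seq (Q := fun s' => s' = s₄.setReg 3 1) (Does.const rfl) ?_
  rintro s₅ hf₅ rfl
  refine Does.seq (Q := fun s' => s' = (s₄.setReg 3 1).setReg 6 n) (Does.copy ?_) ?_
  · congr 1
    rw [hf₅.reg 0 (by decide), hf₄.reg 0 (by decide), hf₃.reg 0 (by decide),
      hf₂.reg 0 (by decide), h0₁]
  rintro s₆ hf₆ rfl
  have h2₆ : ((s₄.setReg 3 1).setReg 6 n).reg 2 = 0 := by
    rw [hf₆.reg 2 (by decide), hf₅.reg 2 (by decide), hf₄.reg 2 (by decide), h2₃]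
  -- Register `6` already holds `n`; multiplying `B` by the constant `1` makes this a plain
  -- addition.
  have := Does.addMul (s := (s₄.setReg 3 1).setReg 6 n) (d := 6) (a := 4) (b := 3) h2₆
    (by decide) (by decide) (by decide)
  simp only [State.setReg_reg, reduceIte, Nat.reduceEqDiff, h₄] at this
  refine this.seq fun s₇ hf₇ h₇ => ?_
  have h0₇ : s₇.reg 0 = n := by
    rw [hf₇.reg 0 (by decide), hf₆.reg 0 (by decide), hf₅.reg 0 (by decide),
      hf₄.reg 0 (by decide), hf₃.reg 0 (by decide), hf₂.reg 0 (by decide), h0₁]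
  have h2₇ : s₇.reg 2 = 0 := by rw [hf₇.reg 2 (by decide), h2₆]
  have h7₇ : s₇.reg 7 = 0 := by
    rw [hf₇.reg 7 (by decide), hf₆.reg 7 (by decide), hf₅.reg 7 (by decide),
      hf₄.reg 7 (by decide), hf₃.reg 7 (by decide), hf₂.reg 7 (by decide),
      hf₁.reg 7 (by decide), h 7 (by omega)]
  rw [mul_one] at h₇
  have := Does.addMul (s := s₇) (d := 7) (a := 0) (b := 6) h2₇ (by decide) (by decide) (by decide)
  rw [h0₇, h₇, h7₇, zero_add] at this
  refine this.imp fun s₈ hf₈ h₈ => ⟨?_, ?_, ?_, ?_, ?_, ?_, ?_, h₈⟩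
  · rw [hf₈.reg 0 (by decide), h0₇]
  · rw [hf₈.reg 1 (by decide), hf₇.reg 1 (by decide), hf₆.reg 1 (by decide),
      hf₅.reg 1 (by decide), hf₄.reg 1 (by decide), hf₃.reg 1 (by decide), h₂]
  · rw [hf₈.reg 2 (by decide), h2₇]
  · rw [hf₈.reg 3 (by decide), hf₇.reg 3 (by decide), hf₆.reg 3 (by decide)]
    rfl
  · rw [hf₈.reg 4 (by decide), hf₇.reg 4 (by decide), hf₆.reg 4 (by decide),
      hf₅.reg 4 (by decide), h₄]
  · rw [hf₈.reg 5 (by decide), hf₇.reg 5 (by decide), hf₆.reg 5 (by decide),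
      hf₅.reg 5 (by decide), hf₄.reg 5 (by decide), hf₃.reg 5 (by decide),
      hf₂.reg 5 (by decide), h₁]
  · rw [hf₈.reg 6 (by decide), h₇]

theorem does_countGuesses (hc : Ctx n t B s) (hB : 0 < B) :
    Does countGuesses s (1 + (2 + t * ((1 + ((2 + B ^ t * (4 + 3 * B)) + 1)) + 2)))
      fun s' => s'.reg 8 = B ^ t := by
  refine Does.seq (Q := fun s' => s' = s.setReg 8 1) (Does.const rfl) ?_
  rintro s₁ hf₁ rfl
  have hc₁ : (s.setReg 8 1).reg 2 = 0 ∧ (s.setReg 8 1).reg 1 = t :=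
    ⟨by simp [hc.reg2], by simp [hc.reg1]⟩
  refine (Does.forRange (a := 0) (b := t) (fun k s' => s'.reg 8 = B ^ k) (by decide) (by decide)
    (by decide) hc₁.1 hc₁.2 (Nat.zero_le _) (by simp) ?_).imp fun _ _ h => h
  intro k s₂ _ hk _ hf₂ h
  refine Does.seq (Q := fun s' => s' = s₂.setReg 26 0) (Does.const rfl) ?_
  rintro s₃ hf₃ rfl
  have h2 : (s₂.setReg 26 0).reg 2 = 0 := by
    rw [hf₃.reg 2 (by decide), hf₂.reg 2 (by decide), hc₁.1]
  have h4 : (s₂.setReg 26 0).reg 4 = B := by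
    rw [hf₃.reg 4 (by decide), hf₂.reg 4 (by decide), hf₁.reg 4 (by decide), hc.reg4]
  have h8 : (s₂.setReg 26 0).reg 8 = B ^ k := by
    rw [hf₃.reg 8 (by decide), h]
  have := Does.addMul (s := s₂.setReg 26 0) (d := 26) (a := 8) (b := 4) h2 (by decide) (by decide)
    (by decide)
  rw [h4, h8] at this
  have hle : B ^ k ≤ B ^ t := Nat.pow_le_pow_right hB hk.le
  refine (this.le (T' := 2 + B ^ t * (4 + 3 * B)) (by gcongr)).seq fun s₄ hf₄ h₄ => Does.copy ?_
  simp [h₄, pow_succ]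

theorem does_copyTable (hc : Ctx n t B s) :
    Does copyTable s (1 + (2 + n * B * 5)) fun s' =>
      ∀ a < n * B, s'.mem a = s.mem (n * n + a) := by
  have hmul : n * (n + B) = n * n + n * B := Nat.mul_add _ _ _
  refine Does.le (T := 1 + (2 + (n * (n + B) - n * n) * ((1 + (1 + 1)) + 2))) ?_
    (by rw [hmul, Nat.add_sub_cancel_left])
  refine Does.seq (Q := fun s' => s' = s.setReg 26 0) (Does.const rfl) ?_
  rintro s₁ hf₁ rfl
  have hc₁ : (s.setReg 26 0).reg 5 = n * n ∧ (s.setReg 26 0).reg 7 = n * (n + B) :=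
    ⟨by simp [hc.reg5], by simp [hc.reg7]⟩
  refine (Does.forRange (a := n * n) (b := n * (n + B)) (fun k s' => s'.reg 26 = k - n * n ∧
    ∀ a, s'.mem a = if a < k - n * n then s.mem (n * n + a) else s.mem a)
    (by decide) (by decide) (by decide) hc₁.1 hc₁.2 (by omega) ⟨by simp, by simp⟩ ?_).imp ?_
  · intro k s₂ hk _ hk' hf₂ ⟨h26, hm⟩
    refine Does.seq (Q := fun s' => s' = s₂.setReg 14 (s.mem k)) (Does.load ?_) ?_
    -- The source cell is still intact: the cells overwritten so far lie below `k - n * n`.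
    · rw [hk', hm k, if_neg]
      have : n = 0 ∨ 0 < n * n := by
        rcases Nat.eq_zero_or_pos n with h | h
        · exact .inl h
        · exact .inr (Nat.mul_pos h h)
      omega
    rintro s₃ - rfl
    refine Does.seq (T := 1) (T' := 1) (Q := fun s' =>
      s' = (s₂.setReg 14 (s.mem k)).setMem (k - n * n) (s.mem k)) (Does.store ?_) ?_
    · simp [h26]
    rintro s₄ - rfl
    refine Does.inc ⟨?_, fun a => ?_⟩
    · simp [h26]
      omega
    · simp only [State.setReg_mem, State.setMem_mem, hm a]
      rcases lt_trichotomy a (k - n * n) with ha | ha | ha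
      · rw [if_neg (by omega), if_pos ha, if_pos (by omega)]
      · rw [if_pos ha, if_pos (by omega)]
        congr 1
        omega
      · rw [if_neg (by omega), if_neg (by omega), if_neg (by omega)]
  · intro s₂ _ h a ha
    rw [h.2 a, if_pos (by omega)]

/-- Once a guess succeeds, the remaining rounds are skipped and its table stays in memory. The
invariant also records that memory holds some table, since a failed try leaves its table behind for
the next one to clear. -/
theorem does_search {L : ℕ} (hc : Ctx n t B s) (hB : 0 < B) (hr : Rep n B E ∅ s)
    (hL : s.reg 8 = L) (h24 : s.reg 24 = 0) :
    Does (forRange 9 2 8 (.cond (.lt 2 24) .skip tryGuess)) s (2 + L * ((1 + tryCost n B L) + 2))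
      fun s' => if s'.reg 24 = 0 then ∀ N < L, ¬ IsCliqueTable n B t E (scan n B E N)
        else ∃ N, IsCliqueTable n B t E (scan n B E N) ∧ Rep n B E (scan n B E N) s' := by
  refine (Does.forRange (a := 0) (b := L) (fun k s' => (∃ S, Rep n B E S s') ∧
    if s'.reg 24 = 0 then ∀ N < k, ¬ IsCliqueTable n B t E (scan n B E N)
      else ∃ N, IsCliqueTable n B t E (scan n B E N) ∧ Rep n B E (scan n B E N) s')
    (by decide) (by decide) (by decide) hc.reg2 hL (Nat.zero_le _)
    ⟨⟨∅, hr.congr rfl⟩, by simp [h24]⟩ ?_).imp fun _ _ h => h.2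
  rintro k s₁ - hk hk' hf₁ ⟨⟨S, hr₁⟩, h₁⟩
  have hc₁ := hc.frame hf₁ (by decide)
  have htry : 1 ≤ tryCost n B L := by unfold tryCost; omega
  refine Does.cond (fun h => (Does.skip ⟨⟨S, hr₁.congr rfl⟩, ?_⟩).le htry) fun h =>
    (does_tryGuess hc₁ hB hr₁ hk' hk.le).imp fun s₂ hf₂ h₂ => ⟨⟨_, h₂.1.congr rfl⟩, ?_⟩
  all_goals
    simp only [Test.Holds, hc₁.reg2, Nat.pos_iff_ne_zero] at h
    simp only [State.setReg_reg, reduceIte, Nat.reduceEqDiff]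
  · rw [if_pos (not_not.1 h)] at h₁
    split_ifs with h'
    · intro N hN
      obtain rfl | hN : N = k ∨ N < k := by omega
      · exact fun hN => h₂.2.2 hN h'
      · exact h₁ N hN
    · exact ⟨k, h₂.2.1 h', h₂.1.congr rfl⟩
  · rw [if_neg h] at h₁ ⊢
    obtain ⟨N, hN, hr⟩ := h₁
    exact ⟨N, hN, hr.congr rfl⟩

/-- The running time of the algorithm. -/
def solverCost (n t B : ℕ) : ℕ :=
  (15 + n * (4 + 3 * n) + B * 7 + n * (4 + 3 * (n + B))) +
    ((1 + (2 + t * ((1 + ((2 + B ^ t * (4 + 3 * B)) + 1)) + 2))) +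
      ((2 + B ^ t * ((1 + tryCost n B (B ^ t)) + 2)) + ((1 + (2 + n * B * 5)) + (1 + 1))))

theorem does_solver (G : SimpleGraph (Fin n)) (t : ℕ) (hB : B = max (min t (n * n)) 1) :
    Does solver (input G t) (solverCost n (min t (n * n)) B)
      fun s => IsCorrectAnswer G t (output n s) := by
  have hB' : 0 < B := by omega
  have hzero : ∀ r, 2 ≤ r → (input G t).reg r = 0 := fun r hr => by
    simp only [input]
    rw [if_neg (by omega), if_neg (by omega)]
  refine (does_prepare (n := n) (t := t) rfl rfl hzero hB).seq fun s₁ hf₁ hc₁ => ?_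
  refine (does_countGuesses hc₁ hB').seq fun s₂ hf₂ h₂ => ?_
  have hc₂ := hc₁.frame hf₂ (by decide)
  have hr : Rep n B (edgeCells G) ∅ s₂ := by
    refine ⟨fun a => ?_, fun a => lt_of_mem_edgeCells, Finset.empty_subset _⟩
    rw [hf₂.mem rfl, hf₁.mem rfl]
    simp [input, edgeCells]
  refine (does_search hc₂ hB' hr h₂ ?_).seq fun s₃ hf₃ h₃ => ?_
  · rw [hf₂.reg 24 (by decide), hf₁.reg 24 (by decide), hzero 24 (by omega)]
  have hc₃ := hc₂.frame hf₃ (by decide)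
  refine (does_copyTable hc₃).seq fun s₄ hf₄ h₄ => ?_
  have hc₄ := hc₃.frame hf₄ (by decide)
  refine Does.seq (Q := fun s' => s' = s₄.setReg 0 (s₃.reg 24)) (Does.copy ?_) ?_
  · rw [hf₄.reg 24 (by decide)]
  rintro s₅ - rfl
  refine Does.copy ?_
  simp only [output, State.setReg_reg, reduceIte, State.setReg_mem,
    zero_ne_one, OfNat.ofNat_ne_zero, hc₄.reg4]
  split_ifs at h₃ ⊢ with h
  -- A solution could be capped, laid out as a table and followed by a guess below `B ^ t`, which
  -- the search would have found.
  · rintro ⟨C, hC⟩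
    obtain ⟨C', hC'⟩ := exists_isSolution_min ⟨C, hC⟩
    obtain ⟨S, hS, hcov⟩ := exists_table (B := B) (by omega) hC'
    obtain ⟨N, hN, hN'⟩ := exists_isCliqueTable_scan hB' hS hcov
    exact h₃ N hN hN'
  · obtain ⟨N, hN, hrN⟩ := h₃
    have hsol := isSolution_of_table hN fun x hx y hy hxy => covered_scan hB' hx hy hxy N
    refine cast (congrArg (IsSolution G t) ?_) (hsol.mono (min_le_left _ _))
    refine Finset.image_congr fun i hi => Finset.filter_congr fun x _ => ?_
    have hi' : i < B := by simpa using hi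
    -- Copying shifts by `n * n` cells, that is by `n` rows, so output row `i` is table row `n + i`.
    have hlt := (Finset.mem_Ico.1 (cell_mem_Ico x.2 (Nat.zero_le i) hi')).2
    rw [h₄ _ hlt, ← add_assoc, ← Nat.mul_add, hrN.row_iff (by omega)]

end

end AssignmentCliqueCover

/-! ### The running time -/

namespace AssignmentCliqueCover

open RAM

theorem cellCost_le {n h m : ℕ} (hn : n ≤ m) (hh : h ≤ m ^ 2) (hm : 1 ≤ m) :
    cellCost n h ≤ 11 * m ^ 3 := by
  have h₁ : m ^ 1 ≤ m ^ 3 := Nat.pow_le_pow_right hm (by omega)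
  have h₀ : m ^ 0 ≤ m ^ 3 := Nat.pow_le_pow_right hm (by omega)
  calc cellCost n h ≤ 4 + m * (4 + 3 * m ^ 2) := by unfold cellCost; gcongr
    _ = 4 * m ^ 0 + 4 * m ^ 1 + 3 * m ^ 3 := by ring
    _ ≤ 11 * m ^ 3 := by omega

/-- The covering test costs `B` cell accesses, of order `m ^ 5`, and the division is of order `L`;
their sum is generously bounded by a product. -/
theorem stepCost_le {n B L m : ℕ} (hn : n ≤ m) (hB : n + B ≤ m ^ 2) (hm : 1 ≤ m) (hL : 1 ≤ L) :
    stepCost n B L ≤ 80 * (m ^ 5 * L) := by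
  have h₃ : m ^ 3 ≤ m ^ 5 := Nat.pow_le_pow_right hm (by omega)
  have h₂ : m ^ 2 ≤ m ^ 5 := Nat.pow_le_pow_right hm (by omega)
  have h₀ : m ^ 0 ≤ m ^ 5 := Nat.pow_le_pow_right hm (by omega)
  have h₅ : m ^ 5 * 1 ≤ m ^ 5 * L := Nat.mul_le_mul_left _ hL
  have h₆ : m ^ 0 * L ≤ m ^ 5 * L := Nat.mul_le_mul_right _ h₀
  have hB' : B ≤ m ^ 2 := by omega
  have hg := cellCost_le hn hB hm
  calc stepCost n B L ≤ 11 * m ^ 3 + (1 + ((3 + m ^ 2 * (2 * (11 * m ^ 3) + 5)) +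
        (1 + ((5 + L * 6) + (11 * m ^ 3 + 11 * m ^ 3))))) := by unfold stepCost; gcongr
    _ = 33 * m ^ 3 + 10 * m ^ 0 + 5 * m ^ 2 + 22 * m ^ 5 + 6 * (m ^ 0 * L) := by ring
    _ ≤ 80 * (m ^ 5 * L) := by omega

theorem scanCost_le {n B L m : ℕ} (hn : n ≤ m) (hB : n + B ≤ m ^ 2) (hm : 1 ≤ m) (hL : 1 ≤ L) :
    scanCost n B L ≤ 90 * (m ^ 7 * L) := by
  have h₂ : m ^ 2 ≤ m ^ 7 := Nat.pow_le_pow_right hm (by omega)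
  have h₁ : m ^ 1 ≤ m ^ 7 := Nat.pow_le_pow_right hm (by omega)
  have h₀ : m ^ 0 ≤ m ^ 7 := Nat.pow_le_pow_right hm (by omega)
  have h₇ : m ^ 7 * 1 ≤ m ^ 7 * L := Nat.mul_le_mul_left _ hL
  have hs := stepCost_le hn hB hm hL
  calc scanCost n B L ≤ 1 + (2 + m * ((2 + m * (80 * (m ^ 5 * L) + 2)) + 2)) := by
        unfold scanCost; gcongr
    _ = 3 * m ^ 0 + 4 * m ^ 1 + 2 * m ^ 2 + 80 * (m ^ 7 * L) := by ring
    _ ≤ 90 * (m ^ 7 * L) := by omega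

theorem cliquesCost_le {n B m : ℕ} (hn : n ≤ m) (hB : n + B ≤ m ^ 2) (hm : 1 ≤ m) :
    cliquesCost n B ≤ 60 * m ^ 7 := by
  have h₄ : m ^ 4 ≤ m ^ 7 := Nat.pow_le_pow_right hm (by omega)
  have h₃ : m ^ 3 ≤ m ^ 7 := Nat.pow_le_pow_right hm (by omega)
  have h₂ : m ^ 2 ≤ m ^ 7 := Nat.pow_le_pow_right hm (by omega)
  have h₀ : m ^ 0 ≤ m ^ 7 := Nat.pow_le_pow_right hm (by omega)
  have hB' : B ≤ m ^ 2 := by omega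
  have hg := cellCost_le hn hB hm
  calc cliquesCost n B ≤ 2 + m ^ 2 * ((2 + m * ((2 + m * ((11 * m ^ 3 + (1 + (11 * m ^ 3 +
        (1 + (1 + (11 * m ^ 3 + 2)))))) + 2)) + 2)) + 2) := by unfold cliquesCost; gcongr
    _ = 2 * m ^ 0 + 4 * m ^ 2 + 4 * m ^ 3 + 7 * m ^ 4 + 33 * m ^ 7 := by ring
    _ ≤ 60 * m ^ 7 := by omega

theorem tryCost_le {n B L m : ℕ} (hn : n ≤ m) (hB : n + B ≤ m ^ 2) (hm : 1 ≤ m) (hL : 1 ≤ L) :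
    tryCost n B L ≤ 170 * (m ^ 7 * L) := by
  have h₃ : m ^ 3 ≤ m ^ 7 := Nat.pow_le_pow_right hm (by omega)
  have h₀ : m ^ 0 ≤ m ^ 7 := Nat.pow_le_pow_right hm (by omega)
  have h₇ : m ^ 7 * 1 ≤ m ^ 7 * L := Nat.mul_le_mul_left _ hL
  have hB' : B ≤ m ^ 2 := by omega
  have hs := scanCost_le hn hB hm hL
  have hc := cliquesCost_le hn hB hm
  calc tryCost n B L ≤ (2 + m * m ^ 2 * 3) + (90 * (m ^ 7 * L) + (1 + ((3 + m * m ^ 2 * 5) +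
        (2 + (60 * m ^ 7 + 1))))) := by unfold tryCost; gcongr
    _ = 9 * m ^ 0 + 8 * m ^ 3 + 60 * m ^ 7 + 90 * (m ^ 7 * L) := by ring
    _ ≤ 170 * (m ^ 7 * L) := by omega

/-- One factor `B ^ t` counts the guesses, the other comes from the divisions; `m ^ 7` is `m ^ 2`
vertex pairs times `m ^ 5`. -/
theorem solverCost_le {n t B m : ℕ} (hn : n ≤ m) (hB : n + B ≤ m ^ 2) (hB' : 0 < B)
    (ht : t ≤ m ^ 2) (hm : 1 ≤ m) : solverCost n t B ≤ 300 * (m ^ 7 * (B ^ t) ^ 2) := by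
  have hL : 1 ≤ B ^ t := Nat.one_le_pow _ _ hB'
  have htry := tryCost_le hn hB hm hL
  unfold solverCost
  generalize B ^ t = L at *
  -- Every lower monomial is dominated by the leading one, so the estimate becomes linear in the
  -- monomials.
  have hp : ∀ k ≤ 7, m ^ k * L ^ 0 ≤ m ^ 7 * L ^ 2 := fun k hk =>
    Nat.mul_le_mul (Nat.pow_le_pow_right hm hk) (Nat.pow_le_pow_right hL (by omega))
  have hq : ∀ k ≤ 7, m ^ k * L ^ 1 ≤ m ^ 7 * L ^ 2 := fun k hk =>
    Nat.mul_le_mul (Nat.pow_le_pow_right hm hk) (Nat.pow_le_pow_right hL (by omega))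
  have hB₂ : B ≤ m ^ 2 := by omega
  calc _ ≤ (15 + m * (4 + 3 * m) + m ^ 2 * 7 + m * (4 + 3 * m ^ 2)) +
      ((1 + (2 + m ^ 2 * ((1 + ((2 + L * (4 + 3 * m ^ 2)) + 1)) + 2))) +
        ((2 + L * ((1 + 170 * (m ^ 7 * L)) + 2)) + ((1 + (2 + m * m ^ 2 * 5)) + (1 + 1)))) := by
        gcongr
    _ = 25 * (m ^ 0 * L ^ 0) + 8 * (m ^ 1 * L ^ 0) + 16 * (m ^ 2 * L ^ 0) +
        8 * (m ^ 3 * L ^ 0) + 4 * (m ^ 2 * L ^ 1) + 3 * (m ^ 4 * L ^ 1) + 3 * (m ^ 0 * L ^ 1) +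
        170 * (m ^ 7 * L ^ 2) := by ring
    _ ≤ 300 * (m ^ 7 * L ^ 2) := by
        linarith [hp 0 (by omega), hp 1 (by omega), hp 2 (by omega), hp 3 (by omega),
          hq 2 (by omega), hq 4 (by omega), hq 0 (by omega)]

/-- Write `4 = 2 ^ 2` and use `2 ^ logb 2 t = t`. For `t = 0` the exponent is `0` and `0 ^ 0 = 1`,
so both sides are `1`. -/
theorem four_rpow_mul_logb (t : ℕ) :
    (4 : ℝ) ^ ((t : ℝ) * Real.logb 2 (t : ℝ)) = ((t : ℝ) ^ t) ^ 2 := by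
  rcases Nat.eq_zero_or_pos t with rfl | ht
  · simp
  · have ht' : (0 : ℝ) < t := Nat.cast_pos.2 ht
    rw [show (4 : ℝ) = (2 : ℝ) ^ (2 : ℝ) by norm_num, ← Real.rpow_mul (by norm_num),
      show (2 : ℝ) * (t * Real.logb 2 t) = Real.logb 2 t * ((t * 2 : ℕ) : ℝ) by push_cast; ring,
      Real.rpow_mul (by norm_num), Real.rpow_logb (by norm_num) (by norm_num) ht',
      Real.rpow_natCast, pow_mul]

/-- The number of guesses, for the bound capped at `k`. -/
theorem max_min_pow_le (t k : ℕ) : max (min t k) 1 ^ min t k ≤ t ^ t := by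
  rcases Nat.eq_zero_or_pos t with rfl | ht
  · simp
  · exact (Nat.pow_le_pow_left (by omega) _).trans (Nat.pow_le_pow_right ht (min_le_left _ _))

end AssignmentCliqueCover

theorem theorem4 :
    ∃ (A : RAM.Prog) (c : ℕ), AssignmentCliqueCover.SolvesInTime A fun n t =>
      (c : ℝ) * (4 : ℝ) ^ ((t : ℝ) * Real.logb 2 (t : ℝ)) * ((n : ℝ) + 1) ^ c := by
  open AssignmentCliqueCover in
  -- One constant serves as factor (at least `300`) and as exponent (at least `7`); it is kept
  -- opaque so that `(n + 1) ^ c` is never expanded.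
  obtain ⟨c, hc⟩ : ∃ c : ℕ, 300 ≤ c := ⟨300, le_rfl⟩
  refine ⟨solver, c, fun n G t => ?_⟩
  obtain ⟨T, s, hx, hT, hs⟩ := does_solver G t rfl
  refine ⟨T, s, hx, hs, ?_⟩
  -- Gives `n + B ≤ (n + 1) ^ 2`, as the capped `B` is at most `max (n * n) 1`.
  have hsq : (n + 1) ^ 2 = n * n + n + n + 1 := by ring
  have h₁ := solverCost_le (n := n) (t := min t (n * n)) (B := max (min t (n * n)) 1) (m := n + 1)
    (by omega) (by omega) (by omega) (by omega) (by omega)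
  have h₂ := max_min_pow_le t (n * n)
  have h₃ : (n + 1) ^ 7 ≤ (n + 1) ^ c := Nat.pow_le_pow_right (by omega) (by omega)
  have h₄ : T ≤ c * (t ^ t) ^ 2 * (n + 1) ^ c :=
    calc T ≤ 300 * ((n + 1) ^ 7 * (max (min t (n * n)) 1 ^ min t (n * n)) ^ 2) := hT.trans h₁
      _ ≤ c * ((n + 1) ^ c * (t ^ t) ^ 2) := by gcongr
      _ = c * (t ^ t) ^ 2 * (n + 1) ^ c := by ring
  simp only [four_rpow_mul_logb]
  exact_mod_cast h₄
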